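/- Let $K(z)=1/z$ for $z\in\mathbb{C}\setminus\{0\}$, and for $\delta>0$ let $K_\delta(z)=\bar z/\max(\delta,|z|)^2$. All measures are non-negative Borel measures on $\mathbb{C}$, and $B(z,r)$ is the open disc with centre $z$ and radius $r>0$. A measure $\mu$ is called $C_0$-nice if $\mu(B(z,r))\le C_0 r$ for all $z\in\mathbb{C}$ and $r>0$. It is called good if for some $C_0>0$ it is $C_0$-nice and the operators $\mathcal{C}_{\mu,\delta}(f)(z)=\int_{\mathbb{C}}K_\delta(z-\xi)f(\xi)\,d\mu(\xi)$ satisfy $\sup_{\delta>0}\|\mathcal{C}_{\mu,\delta}\|_{L^2(\mu)\to L^2(\mu)}\le C_0$. It is called AD-regular if it is $C_0$-nice for some $C_0>0$ and there is $c_0>0$ with $\mu(B(z,r))\ge c_0 r$ for all $z\in\operatorname{supp}(\mu)$ and $r>0$. For compactly supported Lipschitz functions $f,g:\mathbb{C}\to\mathbb{C}$ put $$\langle\mathcal{C}_\mu(f),g\rangle_\mu=\iint_{\mathbb{C}\times\mathbb{C}}K(z-\xi)\,\tfrac12\bigl[f(\xi)g(z)-f(z)g(\xi)\bigr]\,d\mu(z)\,d\mu(\xi).$$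 Let $\Phi^\mu$ be the set of compactly supported $\psi:\mathbb{C}\to\mathbb{C}$ with Lipschitz constant at most $1$ and $\int\psi\,d\mu=0$. For a point $z_0\notin\operatorname{supp}(\mu)$, for $\psi\in\Phi^\mu$, and for a compactly supported Lipschitz function $\varphi$ that equals $1$ on a neighbourhood of $\operatorname{supp}(\psi)$, put $$\langle\widetilde{\mathcal{C}}_\mu(1),\psi\rangle_\mu=\langle\mathcal{C}_\mu(\varphi),\psi\rangle_\mu-\int_{\mathbb{C}} K(z_0-\xi)\varphi(\xi)\,d\mu(\xi)\cdot\int_{\mathbb{C}}\psi\,d\mu+\int_{\mathbb{C}}\psi(z)\int_{\mathbb{C}}(1-\varphi(\xi))\bigl[K(z-\xi)-K(z_0-\xi)\bigr]\,d\mu(\xi)\,d\mu(z).$$ For a good measure $\mu$ and $\psi\in\Phi^\mu$ this number does not depend on the choice of $\varphi$ and $z_0$. A good measure $\mu$ with $\operatorname{supp}(\mu)\ne\mathbb{C}$ is called reflectionless if $\langle\widetilde{\mathcal{C}}_\mu(1),\psi\rangle_\mu=0$ for every $\psi\in\Phi^\mu$. (A good AD-regular measure always has $\operatorname{supp}(\mu)\neq\mathbb{C}$.)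 **Proposition.** Let $\mu$ be a non-zero good AD-regular measure on $\mathbb{C}$ that is reflectionless. Then there are a line $L\subset\mathbb{C}$ and a constant $c>0$ such that $\mu=c\,\mathcal{H}^1|_L$, where $\mathcal{H}^1|_L$ is the one-dimensional Hausdorff measure restricted to $L$. -/

import Mathlib

open MeasureTheory
open scoped ENNReal NNReal Topology

noncomputable section

namespace CauchyTransform

/-- The Cauchy kernel `K(z) = 1 / z`. -/
def kernel (z : ℂ) : ℂ := 1 / z

/-- The regularized Cauchy kernel `K_δ(z) = conj z / max(δ, |z|)²`. -/
def regKernel (δ : ℝ) (z : ℂ) : ℂ := (starRingEnd ℂ) z / ((max δ ‖z‖ : ℝ) : ℂ) ^ 2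

/-- The regularized Cauchy transform `𝒞_{μ,δ}(f)(z) = ∫ K_δ(z - ξ) f(ξ) dμ(ξ)`. -/
def regTransform (μ : Measure ℂ) (δ : ℝ) (f : ℂ → ℂ) (z : ℂ) : ℂ :=
  ∫ ξ, regKernel δ (z - ξ) * f ξ ∂μ

/-- `μ` is `C₀`-nice: `μ(B(z, r)) ≤ C₀ r` for every open disc. -/
def IsNice (μ : Measure ℂ) (C₀ : ℝ) : Prop :=
  ∀ (z : ℂ) (r : ℝ), 0 < r → μ (Metric.ball z r) ≤ ENNReal.ofReal (C₀ * r)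

/-- `μ` is `C₀`-good: it is `C₀`-nice and the operators `𝒞_{μ,δ}`, `δ > 0`, map `L²(μ)` to
`L²(μ)` with norms at most `C₀`. -/
def IsGoodWith (μ : Measure ℂ) (C₀ : ℝ) : Prop :=
  IsNice μ C₀ ∧
    ∀ δ : ℝ, 0 < δ → ∀ f : ℂ → ℂ, MemLp f 2 μ →
      eLpNorm (regTransform μ δ f) 2 μ ≤ ENNReal.ofReal C₀ * eLpNorm f 2 μ

/-- `μ` is good: it is `C₀`-good for some `C₀ > 0`. -/
def IsGood (μ : Measure ℂ) : Prop := ∃ C₀ : ℝ, 0 < C₀ ∧ IsGoodWith μ C₀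

/-- `μ` is AD-regular: it is nice, and `μ(B(z, r)) ≥ c₀ r` for some `c₀ > 0` and every open disc
centred on the support. -/
def IsADRegular (μ : Measure ℂ) : Prop :=
  (∃ C₀ : ℝ, 0 < C₀ ∧ IsNice μ C₀) ∧
    ∃ c₀ : ℝ, 0 < c₀ ∧ ∀ z ∈ μ.support, ∀ r : ℝ, 0 < r →
      ENNReal.ofReal (c₀ * r) ≤ μ (Metric.ball z r)

/-- `Lip₀(ℂ)`: compactly supported functions with finite Lipschitz norm. -/
def IsLipCompact (f : ℂ → ℂ) : Prop :=
  (∃ M : ℝ≥0, LipschitzWith M f) ∧ HasCompactSupport f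

/-- The pairing `⟨𝒞_μ(f), g⟩_μ = I_μ(f, g)` for `f, g ∈ Lip₀(ℂ)`, i.e.
`∬ K(z - ξ) · ½ [f(ξ) g(z) - f(z) g(ξ)] dμ(z) dμ(ξ)`. For a nice measure the integral converges
absolutely, and the value of the kernel at `0` is irrelevant. -/
def pairing (μ : Measure ℂ) (f g : ℂ → ℂ) : ℂ :=
  ∫ p : ℂ × ℂ, kernel (p.1 - p.2) * ((1 / 2) * (f p.2 * g p.1 - f p.1 * g p.2)) ∂(μ.prod μ)

/-- `φ` is an admissible cut-off for `ψ`: it lies in `Lip₀(ℂ)` and equals `1` on a neighbourhood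
of the support of `ψ`. -/
def IsCutoff (φ ψ : ℂ → ℂ) : Prop :=
  IsLipCompact φ ∧ ∀ᶠ ξ in 𝓝ˢ (tsupport ψ), φ ξ = 1

/-- The pairing `⟨𝒞̃_μ(1), ψ⟩_μ`, normalized at a point `z₀` off the support of `μ` and computed
with the cut-off `φ`:
`⟨𝒞_μ(φ), ψ⟩_μ - 𝒞_μ(φ)(z₀) ∫ ψ dμ
  + ∫ ψ(z) ∫ (1 - φ(ξ)) [K(z - ξ) - K(z₀ - ξ)] dμ(ξ) dμ(z)`. -/
def onePairing (μ : Measure ℂ) (z₀ : ℂ) (φ ψ : ℂ → ℂ) : ℂ :=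
  pairing μ φ ψ - (∫ ξ, kernel (z₀ - ξ) * φ ξ ∂μ) * (∫ z, ψ z ∂μ)
    + ∫ z, ψ z * (∫ ξ, (1 - φ ξ) * (kernel (z - ξ) - kernel (z₀ - ξ)) ∂μ) ∂μ

/-- The class `Φ^μ` of compactly supported functions of Lipschitz norm at most `1` with
`μ`-mean zero. -/
def TestClass (μ : Measure ℂ) : Set (ℂ → ℂ) :=
  {ψ | LipschitzWith 1 ψ ∧ HasCompactSupport ψ ∧ ∫ z, ψ z ∂μ = 0}

/-- `μ` is reflectionless: `⟨𝒞̃_μ(1), ψ⟩_μ = 0` for every `ψ ∈ Φ^μ`. For a good measure and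
`ψ ∈ Φ^μ` the pairing depends neither on the cut-off `φ` nor on the normalization point `z₀`
off the support, so it is only asked to vanish for some choice of them. -/
def IsReflectionless (μ : Measure ℂ) : Prop :=
  ∃ z₀ : ℂ, z₀ ∉ μ.support ∧
    ∀ ψ ∈ TestClass μ, ∃ φ : ℂ → ℂ, IsCutoff φ ψ ∧ onePairing μ z₀ φ ψ = 0

end CauchyTransform

end

open MeasureTheory
open scoped ENNReal NNReal Topology

noncomputable section

namespace CauchyTransform

/-! ### Growth bounds for nice measures and decay of the Cauchy kernel. -/

section Basic

/-! The proof shows that the Cauchy transform of `μ`, renormalized to vanish at `z₀`, takes only two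
values off the support, and that a positive measure with such a transform lives on a line. Write `T`
for `renormTransform μ z₀`.

After symmetrization the pairing with `ψ` is an absolutely convergent double integral that no longer
sees the cut-off (`onePairing_eq_integral_symIntegrand`). Being reflectionless, it vanishes on
mean-zero `ψ`, so on all compactly supported Lipschitz `ψ` it equals `lam * ∫ ψ dμ`
(`exists_integral_symIntegrand_eq`). For `w` off the support, insert truncations of `ψ(ξ) = K(w - ξ)
- K(z₀ - ξ)`. A partial-fraction identity factors the symmetrized integrand into `½ ψ(z) ψ(ξ)`, and
in the limit `½ T(w)² = lam T(w)` (`renormTransform_sq`). Thus `T(w)` is `0` or `2 lam`.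

The lower regularity bound makes the support Lebesgue null, so `T = 2 lam 1_Ω` almost everywhere
with `Ω = {T ≠ 0}` off the support. The Cauchy–Pompeiu formula gives `∂T/∂z̄ = π μ` weakly
(`integral_renormTransform_mul_dbar`). As `1_Ω` is real, its derivative along `e` is then `π Re(lam
e) / |lam|² · μ`: the gradient has constant direction, with a sign given by the positivity of `μ`.
Translating bumps shows that `Ω` is a half-plane up to a null set (`exists_ae_eq_halfPlane`), and
the gradient of its indicator is a multiple of arc length on the bounding line
(`exists_line_eq_smul_hausdorffMeasure`). -/

theorem IsNice.isLocallyFiniteMeasure {μ : Measure ℂ} {C₀ : ℝ} (h : IsNice μ C₀) :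
    IsLocallyFiniteMeasure μ :=
  ⟨fun z => ⟨Metric.ball z 1, Metric.ball_mem_nhds z one_pos,
    (h z 1 one_pos).trans_lt ENNReal.ofReal_lt_top⟩⟩

theorem IsNice.nullSingletonClass {μ : Measure ℂ} {C₀ : ℝ} (h : IsNice μ C₀) :
    NullSingletonClass μ := by
  refine ⟨fun z => ?_⟩
  have hlim : Filter.Tendsto (fun r : ℝ => ENNReal.ofReal (C₀ * r)) (𝓝[>] 0) (𝓝 0) := by
    have : Filter.Tendsto (fun r : ℝ => ENNReal.ofReal (C₀ * r)) (𝓝 0)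
        (𝓝 (ENNReal.ofReal (C₀ * 0))) := by
      apply ENNReal.tendsto_ofReal
      exact (continuous_const.mul continuous_id).tendsto 0
    simpa using this.mono_left nhdsWithin_le_nhds
  refine le_antisymm (ge_of_tendsto hlim ?_) zero_le
  filter_upwards [self_mem_nhdsWithin] with r hr
  exact (measure_mono (by simpa using hr)).trans (h z r hr)

/-- Layer-cake: the superlevel set at height `t` is empty for `t ≥ 1`, and for `0 < t < 1` it lies
in a disc of radius `t ^ (-1/s)`. Linear growth then leaves `∫₀¹ t ^ (-1/s) dt`, finite because `s >
1`. -/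
theorem IsNice.integrable_one_add_norm_rpow {μ : Measure ℂ} {C₀ : ℝ} (h : IsNice μ C₀)
    {s : ℝ} (hs : 1 < s) : Integrable (fun ξ : ℂ => (1 + ‖ξ‖) ^ (-s)) μ := by
  have hs0 : 0 < s := one_pos.trans hs
  have hcont : Continuous (fun ξ : ℂ => (1 + ‖ξ‖) ^ (-s)) := by
    refine (by fun_prop : Continuous fun ξ : ℂ => 1 + ‖ξ‖).rpow_const fun ξ => Or.inl ?_
    positivity
  refine ⟨hcont.aestronglyMeasurable, ?_⟩
  rw [hasFiniteIntegral_iff_ofReal (.of_forall fun ξ => by positivity),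
    lintegral_eq_lintegral_meas_lt μ (.of_forall fun ξ => by positivity) hcont.aemeasurable]
  have hint : IntegrableOn (fun t : ℝ => C₀ * t ^ (-s⁻¹)) (Set.Ioo 0 1) := by
    refine Integrable.const_mul ?_ C₀
    refine (intervalIntegral.integrableOn_Ioo_rpow_iff one_pos).2 ?_
    have := inv_lt_one_of_one_lt₀ hs
    linarith
  refine lt_of_le_of_lt ?_ hint.lintegral_lt_top
  rw [← lintegral_indicator measurableSet_Ioi, ← lintegral_indicator measurableSet_Ioo]
  refine lintegral_mono fun t => ?_
  by_cases ht0 : 0 < t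
  · by_cases ht1 : t < 1
    · rw [Set.indicator_of_mem (Set.mem_Ioi.2 ht0), Set.indicator_of_mem (Set.mem_Ioo.2 ⟨ht0, ht1⟩)]
      refine (measure_mono ?_).trans (h 0 (t ^ (-s⁻¹)) (by positivity))
      intro ξ hξ
      have hξ' : t < (1 + ‖ξ‖) ^ (-s) := hξ
      have hneg : -s⁻¹ < 0 := by simpa using hs0
      have := Real.rpow_lt_rpow_of_neg ht0 hξ' hneg
      rw [← Real.rpow_mul (by positivity), neg_mul_neg, mul_inv_cancel₀ hs0.ne',
        Real.rpow_one] at this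
      rw [mem_ball_zero_iff]
      linarith
    · have hempty : {a : ℂ | t < (1 + ‖a‖) ^ (-s)} = ∅ := by
        refine Set.eq_empty_of_forall_notMem fun ξ hξ => ht1 ?_
        exact lt_of_lt_of_le hξ
          (Real.rpow_le_one_of_one_le_of_nonpos (by simp) (by linarith))
      rw [Set.indicator_of_mem (Set.mem_Ioi.2 ht0), hempty]
      simp
  · rw [Set.indicator_of_notMem (by simpa using ht0)]
    exact zero_le

theorem ae_mem_support (μ : Measure ℂ) : ∀ᵐ ξ ∂μ, ξ ∈ μ.support := Measure.support_mem_ae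

theorem ae_prod_mem_support (μ : Measure ℂ) [SFinite μ] :
    ∀ᵐ p ∂(μ.prod μ), p.1 ∈ μ.support ∧ p.2 ∈ μ.support :=
  (Measure.quasiMeasurePreserving_fst.ae (ae_mem_support μ)).and
    (Measure.quasiMeasurePreserving_snd.ae (ae_mem_support μ))

theorem ae_prod_ne (ν μ : Measure ℂ) [SFinite μ] [NullSingletonClass μ] :
    ∀ᵐ p ∂(ν.prod μ), p.1 ≠ p.2 := by
  have hm : MeasurableSet {p : ℂ × ℂ | p.1 ≠ p.2} :=
    (isClosed_eq continuous_fst continuous_snd).measurableSet.compl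
  rw [Measure.ae_prod_iff_ae_ae hm]
  refine .of_forall fun z => ?_
  filter_upwards [Measure.ae_ne μ z] with ξ hξ using hξ.symm

theorem kernel_neg (z : ℂ) : kernel (-z) = -kernel z := by simp [kernel]

theorem kernel_sub_comm (z w : ℂ) : kernel (w - z) = -kernel (z - w) := by
  rw [← kernel_neg, neg_sub]

theorem kernel_zero : kernel 0 = 0 := by simp [kernel]

@[fun_prop]
theorem measurable_kernel : Measurable kernel := by
  unfold kernel
  fun_prop

theorem norm_kernel (z : ℂ) : ‖kernel z‖ = ‖z‖⁻¹ := by simp [kernel]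

theorem kernel_sub_kernel {a b : ℂ} (ha : a ≠ 0) (hb : b ≠ 0) :
    kernel a - kernel b = (b - a) * (kernel a * kernel b) := by
  unfold kernel
  field_simp

theorem norm_kernel_le {A : ℝ} {w ξ : ℂ} (h : 1 + ‖ξ‖ ≤ A * ‖w - ξ‖) :
    ‖kernel (w - ξ)‖ ≤ A * (1 + ‖ξ‖)⁻¹ := by
  have h0 : 0 < A * ‖w - ξ‖ := lt_of_lt_of_le (by positivity) h
  have h1 : 0 < ‖w - ξ‖ := by
    rcases (norm_nonneg (w - ξ)).eq_or_lt with h2 | h2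
    · rw [← h2] at h0; simp at h0
    · exact h2
  rw [norm_kernel, ← div_eq_mul_inv, inv_le_iff_one_le_mul₀ h1, div_mul_eq_mul_div,
    le_div_iff₀ (by positivity)]
  linarith

theorem ne_of_one_add_norm_le {A : ℝ} {w ξ : ℂ} (h : 1 + ‖ξ‖ ≤ A * ‖w - ξ‖) : w - ξ ≠ 0 := by
  rintro h0
  rw [h0, norm_zero, mul_zero] at h
  linarith [norm_nonneg ξ]

/-- One inequality records both that `v` stays away from `E` and that `‖v - ξ‖` is comparable to
`‖ξ‖` at infinity. Uniformity in `v` near `w` supplies the domination for continuity of the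
transform. -/
theorem eventually_one_add_norm_le {E : Set ℂ} (hE : IsClosed E) {w : ℂ} (hw : w ∉ E) :
    ∃ A : ℝ, 0 < A ∧ ∀ᶠ v in 𝓝 w, ∀ ξ ∈ E, 1 + ‖ξ‖ ≤ A * ‖v - ξ‖ := by
  obtain ⟨d, hd, hball⟩ := Metric.isOpen_iff.1 hE.isOpen_compl w hw
  refine ⟨(2 + ‖w‖ + d) / (d / 2) + 1, by positivity, ?_⟩
  filter_upwards [Metric.ball_mem_nhds w (show 0 < min (d / 2) 1 by positivity)] with v hv ξ hξ
  have hv1 : ‖v - w‖ < d / 2 := by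
    simpa [dist_eq_norm] using (Metric.mem_ball.1 hv).trans_le (min_le_left _ _)
  have hv2 : ‖v - w‖ < 1 := by
    simpa [dist_eq_norm] using (Metric.mem_ball.1 hv).trans_le (min_le_right _ _)
  have hξd : d ≤ ‖ξ - w‖ := by
    by_contra hlt
    exact hball (by simpa [dist_eq_norm] using hlt) hξ
  have h3 : ‖ξ - w‖ ≤ ‖v - ξ‖ + ‖v - w‖ := by
    have := norm_sub_le (v - w) (v - ξ)
    rw [show v - w - (v - ξ) = ξ - w by ring] at this
    linarith
  have h4 : ‖ξ‖ ≤ ‖ξ - w‖ + ‖w‖ := by simpa using norm_add_le (ξ - w) w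
  have h5 : d / 2 ≤ ‖v - ξ‖ := by linarith
  have h6 : 2 + ‖w‖ + d ≤ (2 + ‖w‖ + d) / (d / 2) * ‖v - ξ‖ := by
    rw [div_mul_eq_mul_div, le_div_iff₀ (by positivity)]
    gcongr
  nlinarith

theorem exists_one_add_norm_le {E : Set ℂ} (hE : IsClosed E) {w : ℂ} (hw : w ∉ E) :
    ∃ A : ℝ, 0 < A ∧ ∀ ξ ∈ E, 1 + ‖ξ‖ ≤ A * ‖w - ξ‖ := by
  obtain ⟨A, hA, h⟩ := eventually_one_add_norm_le hE hw
  exact ⟨A, hA, h.self_of_nhds⟩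

/-- The reason for renormalizing at a point: `1/|ξ|` need not be integrable against a measure of
linear growth, while the difference decays like `|ξ|⁻²`. -/
theorem norm_kernel_sub_kernel_le {A B : ℝ} {w z ξ : ℂ} (hw : 1 + ‖ξ‖ ≤ A * ‖w - ξ‖)
    (hz : 1 + ‖ξ‖ ≤ B * ‖z - ξ‖) :
    ‖kernel (w - ξ) - kernel (z - ξ)‖ ≤ ‖z - w‖ * (A * B) * (1 + ‖ξ‖) ^ (-2 : ℝ) := by
  have h1 := norm_kernel_le hw
  have h2 := norm_kernel_le hz
  have h3 : (1 + ‖ξ‖) ^ (-2 : ℝ) = (1 + ‖ξ‖)⁻¹ * (1 + ‖ξ‖)⁻¹ := by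
    rw [Real.rpow_neg (by positivity), ← mul_inv]
    norm_num [sq]
  rw [kernel_sub_kernel (ne_of_one_add_norm_le hw) (ne_of_one_add_norm_le hz), norm_mul, norm_mul,
    show z - ξ - (w - ξ) = z - w by ring, h3, mul_assoc ‖z - w‖]
  refine mul_le_mul_of_nonneg_left ?_ (norm_nonneg _)
  calc ‖kernel (w - ξ)‖ * ‖kernel (z - ξ)‖
      ≤ (A * (1 + ‖ξ‖)⁻¹) * (B * (1 + ‖ξ‖)⁻¹) :=
        mul_le_mul h1 h2 (norm_nonneg _) ((norm_nonneg _).trans h1)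
    _ = _ := by ring

end Basic

/-! ### The pairing as an absolutely convergent symmetric double integral. -/

section Symmetrization

/-- The symmetrized, absolutely integrable integrand of the pairing of the renormalized Cauchy
transform of `1` with `ψ`. -/
def symIntegrand (z₀ : ℂ) (ψ : ℂ → ℂ) (p : ℂ × ℂ) : ℂ :=
  (1 / 2) * (ψ p.1 * (kernel (p.1 - p.2) - kernel (z₀ - p.2))
    + ψ p.2 * (kernel (p.2 - p.1) - kernel (z₀ - p.1)))

theorem IsLipCompact.continuous {f : ℂ → ℂ} (hf : IsLipCompact f) : Continuous f := by
  obtain ⟨⟨M, hM⟩, -⟩ := hf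
  exact hM.continuous

theorem IsLipCompact.exists_bound {f : ℂ → ℂ} (hf : IsLipCompact f) :
    ∃ B : ℝ, 0 ≤ B ∧ ∀ z, ‖f z‖ ≤ B := by
  obtain ⟨B, hB⟩ := hf.2.exists_bound_of_continuous hf.continuous
  exact ⟨B, (norm_nonneg _).trans (hB 0), hB⟩

theorem IsLipCompact.integrable {f : ℂ → ℂ} (hf : IsLipCompact f) (μ : Measure ℂ)
    [IsLocallyFiniteMeasure μ] : Integrable f μ :=
  hf.continuous.integrable_of_hasCompactSupport hf.2

theorem IsLipCompact.const_mul {f : ℂ → ℂ} (hf : IsLipCompact f) (c : ℂ) :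
    IsLipCompact fun z => c * f z := by
  obtain ⟨⟨M, hM⟩, hc⟩ := hf
  refine ⟨⟨‖c‖₊ * M, LipschitzWith.of_dist_le_mul fun x y => ?_⟩, hc.mul_left⟩
  have := hM.dist_le_mul x y
  rw [dist_eq_norm] at this ⊢
  rw [← mul_sub, norm_mul, NNReal.coe_mul, coe_nnnorm, mul_assoc]
  gcongr

theorem IsLipCompact.sub {f g : ℂ → ℂ} (hf : IsLipCompact f) (hg : IsLipCompact g) :
    IsLipCompact fun z => f z - g z := by
  obtain ⟨⟨M, hM⟩, hc⟩ := hf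
  obtain ⟨⟨N, hN⟩, hd⟩ := hg
  exact ⟨⟨M + N, hM.sub hN⟩, hc.sub hd⟩

theorem norm_kernel_mul_le {C : ℝ} (hC : 0 ≤ C) {z x : ℂ} (h : ‖x‖ ≤ C * ‖z‖) :
    ‖kernel z * x‖ ≤ C := by
  rcases eq_or_ne z 0 with rfl | hz
  · simpa [kernel_zero] using hC
  · have : 0 < ‖z‖ := norm_pos_iff.2 hz
    rw [norm_mul, norm_kernel, inv_mul_le_iff₀ this]
    linarith

variable {μ : Measure ℂ} {C₀ : ℝ}

/-- Antisymmetrization makes the bracket `O(|z - ξ|)`, which cancels the singularity; the integrand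
is bounded and lives on a compact set. -/
theorem integrable_pairing [IsLocallyFiniteMeasure μ] {f g : ℂ → ℂ}
    (hf : IsLipCompact f) (hg : IsLipCompact g) :
    Integrable (fun p : ℂ × ℂ =>
      kernel (p.1 - p.2) * ((1 / 2) * (f p.2 * g p.1 - f p.1 * g p.2))) (μ.prod μ) := by
  obtain ⟨B, hB0, hB⟩ := hf.exists_bound
  obtain ⟨D, hD0, hD⟩ := hg.exists_bound
  have hfm : Measurable f := hf.continuous.measurable
  have hgm : Measurable g := hg.continuous.measurable
  obtain ⟨⟨M, hM⟩, hfc⟩ := hf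
  obtain ⟨⟨N, hN⟩, hgc⟩ := hg
  have hK : IsCompact (tsupport f ∪ tsupport g) := hfc.isCompact.union hgc.isCompact
  have hKf : ∀ z, z ∉ tsupport f ∪ tsupport g → f z = 0 ∧ g z = 0 := fun z hz =>
    ⟨image_eq_zero_of_notMem_tsupport fun h => hz (Or.inl h),
      image_eq_zero_of_notMem_tsupport fun h => hz (Or.inr h)⟩
  set S := (tsupport f ∪ tsupport g) ×ˢ (tsupport f ∪ tsupport g) with hS
  refine IntegrableOn.integrable_of_forall_notMem_eq_zero (s := S) ?_ ?_
  · refine Measure.integrableOn_of_bounded (M := M * D + B * N) ?_ ?_ (.of_forall fun p => ?_)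
    · exact ((hK.prod hK).measure_lt_top).ne
    · exact Measurable.aestronglyMeasurable (by fun_prop)
    · refine norm_kernel_mul_le (by positivity) ?_
      have h1 : f p.2 * g p.1 - f p.1 * g p.2
          = (f p.2 - f p.1) * g p.1 + f p.1 * (g p.1 - g p.2) := by ring
      have h2 : ‖f p.2 - f p.1‖ ≤ M * ‖p.1 - p.2‖ := by
        have := hM.dist_le_mul p.2 p.1
        rwa [dist_eq_norm, dist_comm, dist_eq_norm] at this
      have h3 : ‖g p.1 - g p.2‖ ≤ N * ‖p.1 - p.2‖ := by
        have := hN.dist_le_mul p.1 p.2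
        rwa [dist_eq_norm, dist_eq_norm] at this
      have h4 : ‖f p.2 * g p.1 - f p.1 * g p.2‖ ≤ (M * D + B * N) * ‖p.1 - p.2‖ := by
        rw [h1]
        refine (norm_add_le _ _).trans ?_
        rw [norm_mul, norm_mul]
        calc _ ≤ (M * ‖p.1 - p.2‖) * D + B * (N * ‖p.1 - p.2‖) := by
              gcongr
              · exact hD _
              · exact hB _
          _ = _ := by ring
      rw [norm_mul]
      have h5 : ‖(1 / 2 : ℂ)‖ = 1 / 2 := by norm_num
      rw [h5]
      linarith [norm_nonneg (f p.2 * g p.1 - f p.1 * g p.2)]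
  · intro p hp
    have : p.1 ∉ tsupport f ∪ tsupport g ∨ p.2 ∉ tsupport f ∪ tsupport g := by
      by_contra! h
      exact hp ⟨h.1, h.2⟩
    rcases this with h | h
    · simp [(hKf _ h).1, (hKf _ h).2]
    · simp [(hKf _ h).1, (hKf _ h).2]

theorem integrable_kernel_mul [IsLocallyFiniteMeasure μ] {z₀ : ℂ} (hz₀ : z₀ ∉ μ.support)
    {φ : ℂ → ℂ} (hφ : IsLipCompact φ) : Integrable (fun ξ => kernel (z₀ - ξ) * φ ξ) μ := by
  obtain ⟨A, hA, h⟩ := exists_one_add_norm_le μ.isClosed_support hz₀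
  refine (hφ.integrable μ).bdd_mul (c := A) (Measurable.aestronglyMeasurable (by fun_prop)) ?_
  filter_upwards [ae_mem_support μ] with ξ hξ
  refine (norm_kernel_le (h ξ hξ)).trans (mul_le_of_le_one_right hA.le ?_)
  exact inv_le_one_of_one_le₀ (by simp)

/-- Where `φ ≠ 1` the second variable stays at a fixed distance from the support of `ψ`, so the
kernel is not singular there and the difference has quadratic decay. -/
theorem integrable_far (hn : IsNice μ C₀) {z₀ : ℂ} (hz₀ : z₀ ∉ μ.support) {φ ψ : ℂ → ℂ}
    (hφ : IsCutoff φ ψ) (hψ : IsLipCompact ψ) :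
    Integrable (fun p : ℂ × ℂ =>
      ψ p.1 * ((1 - φ p.2) * (kernel (p.1 - p.2) - kernel (z₀ - p.2)))) (μ.prod μ) := by
  have := hn.isLocallyFiniteMeasure
  obtain ⟨A, hA, hA'⟩ := exists_one_add_norm_le μ.isClosed_support hz₀
  obtain ⟨B, hB0, hB⟩ := hφ.1.exists_bound
  obtain ⟨U, hUo, hU, hUφ⟩ := mem_nhdsSet_iff_exists.1 hφ.2
  obtain ⟨d, hd, hdU⟩ := hψ.2.isCompact.exists_thickening_subset_open hUo hU
  obtain ⟨R, hR⟩ := hψ.2.isCompact.isBounded.exists_norm_le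
  have hφm : Measurable φ := hφ.1.continuous.measurable
  have hψm : Measurable ψ := hψ.continuous.measurable
  set a : ℝ := (1 + |R|) / d + 1 with ha
  have ha0 : 0 < a := by positivity
  have hdom : Integrable (fun p : ℂ × ℂ =>
      ‖ψ p.1‖ * (((1 + B) * ((‖z₀‖ + |R|) * (a * A))) * (1 + ‖p.2‖) ^ (-2 : ℝ))) (μ.prod μ) :=
    (hψ.integrable μ).norm.mul_prod
      ((hn.integrable_one_add_norm_rpow (by norm_num : (1 : ℝ) < 2)).const_mul _)
  refine hdom.mono' (Measurable.aestronglyMeasurable (by fun_prop)) ?_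
  filter_upwards [ae_prod_mem_support μ] with p hp
  rw [norm_mul]
  by_cases hz : p.1 ∈ tsupport ψ
  · refine mul_le_mul_of_nonneg_left ?_ (norm_nonneg _)
    by_cases hξ : φ p.2 = 1
    · rw [hξ, sub_self, zero_mul, norm_zero]
      positivity
    · have hdist : d ≤ ‖p.1 - p.2‖ := by
        by_contra! hlt
        refine hξ (hUφ (hdU (Metric.mem_thickening_iff.2 ⟨p.1, hz, ?_⟩)))
        rwa [dist_comm, dist_eq_norm]
      have hz1 : ‖p.1‖ ≤ |R| := (hR _ hz).trans (le_abs_self R)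
      have h1 : 1 + ‖p.2‖ ≤ a * ‖p.1 - p.2‖ := by
        have h2 : ‖p.2‖ ≤ ‖p.1‖ + ‖p.1 - p.2‖ := by
          simpa using norm_sub_le p.1 (p.1 - p.2)
        have h3 : 1 + |R| ≤ (1 + |R|) / d * ‖p.1 - p.2‖ := by
          rw [div_mul_eq_mul_div, le_div_iff₀ hd]
          gcongr
        rw [ha]
        linarith
      rw [norm_mul, mul_assoc]
      refine mul_le_mul ?_ ((norm_kernel_sub_kernel_le h1 (hA' _ hp.2)).trans ?_)
        (norm_nonneg _) (by positivity)
      · refine (norm_sub_le _ _).trans ?_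
        rw [norm_one]
        gcongr
        exact hB _
      · gcongr
        exact (norm_sub_le _ _).trans (by gcongr)
  · rw [image_eq_zero_of_notMem_tsupport hz]
    simp

/-- The first term of the pairing is already invariant under swapping the variables. Averaging the
other two over the swap makes the `φ` and `1 - φ` contributions recombine, and `φ` disappears. -/
theorem onePairing_eq_integral_symIntegrand (hn : IsNice μ C₀) {z₀ : ℂ} (hz₀ : z₀ ∉ μ.support)
    {φ ψ : ℂ → ℂ} (hφ : IsCutoff φ ψ) (hψ : IsLipCompact ψ) :
    Integrable (symIntegrand z₀ ψ) (μ.prod μ) ∧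
      onePairing μ z₀ φ ψ = ∫ p, symIntegrand z₀ ψ p ∂(μ.prod μ) := by
  have := hn.isLocallyFiniteMeasure
  have hP := integrable_pairing (μ := μ) hφ.1 hψ
  have hN := (hψ.integrable μ).mul_prod (integrable_kernel_mul hz₀ hφ.1)
  have hF := integrable_far hn hz₀ hφ hψ
  have hQ := hF.sub hN
  have hQs := hQ.swap
  have hS : symIntegrand z₀ ψ = fun p => kernel (p.1 - p.2) *
      ((1 / 2) * (φ p.2 * ψ p.1 - φ p.1 * ψ p.2)) + (1 / 2) *
      ((ψ p.1 * ((1 - φ p.2) * (kernel (p.1 - p.2) - kernel (z₀ - p.2)))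
        - ψ p.1 * (kernel (z₀ - p.2) * φ p.2)) +
      (ψ p.2 * ((1 - φ p.1) * (kernel (p.2 - p.1) - kernel (z₀ - p.1)))
        - ψ p.2 * (kernel (z₀ - p.1) * φ p.1))) := by
    funext p
    rw [symIntegrand, kernel_sub_comm p.1 p.2]
    ring
  have hsum := (hQ.add hQs).const_mul (1 / 2 : ℂ)
  refine ⟨?_, ?_⟩
  · rw [hS]
    exact hP.add hsum
  · have hswap := integral_prod_swap (μ := μ) (ν := μ) (fun p : ℂ × ℂ =>
      ψ p.1 * ((1 - φ p.2) * (kernel (p.1 - p.2) - kernel (z₀ - p.2)))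
        - ψ p.1 * (kernel (z₀ - p.2) * φ p.2))
    simp only [Prod.fst_swap, Prod.snd_swap] at hswap
    have h2 := integral_add hP hsum
    have h3 := integral_add hQ hQs
    have h4 := integral_sub hF hN
    have h5 := integral_prod_mul (μ := μ) (ν := μ) ψ (fun ξ => kernel (z₀ - ξ) * φ ξ)
    have h6 := integral_prod _ hF
    simp only [Pi.add_apply, Pi.sub_apply, Function.comp_apply, Prod.fst_swap, Prod.snd_swap,
      integral_const_mul] at h2 h3 h4 h6
    rw [hS, h2, h3, hswap, h4, h5, h6, onePairing, pairing]
    ring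

theorem abs_max_zero_sub_le (a b : ℝ) : |max 0 a - max 0 b| ≤ |a - b| := by
  simpa using abs_max_sub_max_le_max 0 a 0 b

/-- The tent of radius `R`. -/
def tent (R : ℝ) (z : ℂ) : ℝ := max 0 (1 - ‖z‖ / R)

theorem tent_nonneg (R : ℝ) (z : ℂ) : 0 ≤ tent R z := le_max_left _ _

theorem tent_le_one {R : ℝ} (hR : 0 < R) (z : ℂ) : tent R z ≤ 1 :=
  max_le zero_le_one (by have : 0 ≤ ‖z‖ / R := by positivity
                         linarith)

theorem tent_eq_zero {R : ℝ} (hR : 0 < R) {z : ℂ} (hz : R ≤ ‖z‖) : tent R z = 0 := by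
  refine max_eq_left ?_
  have : 1 ≤ ‖z‖ / R := by rwa [one_le_div hR]
  linarith

theorem hasCompactSupport_tent {R : ℝ} (hR : 0 < R) : HasCompactSupport (tent R) :=
  HasCompactSupport.intro (isCompact_closedBall (0 : ℂ) R) fun z hz => tent_eq_zero hR (by
    simp only [Metric.mem_closedBall, dist_zero_right, not_le] at hz
    exact hz.le)

theorem abs_tent_sub_le {R : ℝ} (hR : 0 < R) (z ξ : ℂ) :
    |tent R z - tent R ξ| ≤ ‖z - ξ‖ / R := by
  refine (abs_max_zero_sub_le _ _).trans ?_
  rw [show 1 - ‖z‖ / R - (1 - ‖ξ‖ / R) = (‖ξ‖ - ‖z‖) / R by ring, abs_div, abs_of_pos hR,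
    norm_sub_rev]
  gcongr
  exact abs_norm_sub_norm_le _ _

theorem exists_isCutoff {ψ : ℂ → ℂ} (hψ : HasCompactSupport ψ) : ∃ φ, IsCutoff φ ψ := by
  obtain ⟨R, hR⟩ := hψ.isCompact.isBounded.exists_norm_le
  set r : ℝ := |R| + 1 with hr
  have hr0 : 0 < r := by positivity
  refine ⟨fun z => ((min 1 (2 * tent (2 * r) z) : ℝ) : ℂ), ⟨⟨1 / r |>.toNNReal, ?_⟩, ?_⟩, ?_⟩
  · refine LipschitzWith.of_dist_le_mul fun z ξ => ?_
    rw [dist_eq_norm, dist_eq_norm, ← Complex.ofReal_sub, Complex.norm_real, Real.norm_eq_abs,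
      Real.coe_toNNReal _ (by positivity)]
    have h1 := abs_min_sub_min_le_max 1 (2 * tent (2 * r) z) 1 (2 * tent (2 * r) ξ)
    rw [sub_self, abs_zero, max_eq_right (abs_nonneg _), ← mul_sub, abs_mul, abs_two] at h1
    have h2 := abs_tent_sub_le (R := 2 * r) (by positivity) z ξ
    calc _ ≤ 2 * (‖z - ξ‖ / (2 * r)) := by linarith
      _ = _ := by field_simp
  · refine HasCompactSupport.intro (isCompact_closedBall (0 : ℂ) (2 * r)) fun z hz => ?_
    simp only [Metric.mem_closedBall, dist_zero_right, not_le] at hz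
    simp [tent_eq_zero (show (0 : ℝ) < 2 * r by positivity) hz.le]
  · refine mem_nhdsSet_iff_exists.2 ⟨Metric.ball 0 r, Metric.isOpen_ball, fun z hz => ?_,
      fun z hz => ?_⟩
    · have := (hR z hz).trans (le_abs_self R)
      rw [mem_ball_zero_iff]
      linarith
    · rw [mem_ball_zero_iff] at hz
      have h1 : ‖z‖ / (2 * r) ≤ 1 / 2 := by
        rw [div_le_div_iff₀ (by positivity) (by positivity)]
        linarith
      have h2 : 1 - ‖z‖ / (2 * r) ≤ tent (2 * r) z := le_max_right _ _
      have h3 : min 1 (2 * tent (2 * r) z) = 1 := min_eq_left (by linarith)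
      change ((min 1 (2 * tent (2 * r) z) : ℝ) : ℂ) = 1
      rw [h3, Complex.ofReal_one]

theorem integrable_symIntegrand (hn : IsNice μ C₀) {z₀ : ℂ} (hz₀ : z₀ ∉ μ.support)
    {ψ : ℂ → ℂ} (hψ : IsLipCompact ψ) : Integrable (symIntegrand z₀ ψ) (μ.prod μ) := by
  obtain ⟨φ, hφ⟩ := exists_isCutoff hψ.2
  exact (onePairing_eq_integral_symIntegrand hn hz₀ hφ hψ).1

theorem symIntegrand_const_mul (z₀ c : ℂ) (ψ : ℂ → ℂ) (p : ℂ × ℂ) :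
    symIntegrand z₀ (fun z => c * ψ z) p = c * symIntegrand z₀ ψ p := by
  simp only [symIntegrand]
  ring

theorem symIntegrand_sub (z₀ : ℂ) (f g : ℂ → ℂ) (p : ℂ × ℂ) :
    symIntegrand z₀ (fun z => f z - g z) p = symIntegrand z₀ f p - symIntegrand z₀ g p := by
  simp only [symIntegrand]
  ring

/-- Dividing by the Lipschitz constant plus one puts `ψ` into the test class, and linearity undoes
the scaling. -/
theorem integral_symIntegrand_eq_zero (hn : IsNice μ C₀) {z₀ : ℂ} (hz₀ : z₀ ∉ μ.support)
    (h : ∀ ψ ∈ TestClass μ, ∃ φ : ℂ → ℂ, IsCutoff φ ψ ∧ onePairing μ z₀ φ ψ = 0)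
    {ψ : ℂ → ℂ} (hψ : IsLipCompact ψ) (hmean : ∫ z, ψ z ∂μ = 0) :
    ∫ p, symIntegrand z₀ ψ p ∂(μ.prod μ) = 0 := by
  obtain ⟨⟨M, hM⟩, hc⟩ := id hψ
  set c : ℂ := ((((M : ℝ) + 1)⁻¹ : ℝ) : ℂ) with hcdef
  have hcn : ‖c‖ = ((M : ℝ) + 1)⁻¹ := by
    rw [hcdef, Complex.norm_real, Real.norm_of_nonneg (by positivity)]
  have hc0 : c ≠ 0 := by
    rw [← norm_pos_iff, hcn]
    positivity
  have hmem : (fun z => c * ψ z) ∈ TestClass μ := by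
    refine ⟨LipschitzWith.of_dist_le_mul fun x y => ?_, hc.mul_left, ?_⟩
    · have := hM.dist_le_mul x y
      rw [dist_eq_norm] at this ⊢
      rw [← mul_sub, norm_mul, hcn, inv_mul_le_iff₀ (by positivity), NNReal.coe_one, one_mul]
      nlinarith [dist_nonneg (x := x) (y := y)]
    · rw [integral_const_mul, hmean, mul_zero]
  obtain ⟨φ, hφ, h0⟩ := h _ hmem
  have hcψ := hψ.const_mul c
  rw [(onePairing_eq_integral_symIntegrand hn hz₀ hφ hcψ).2] at h0
  simp only [symIntegrand_const_mul, integral_const_mul] at h0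
  exact (mul_eq_zero.1 h0).resolve_left hc0

/-- A linear functional that vanishes on the kernel of `ψ ↦ ∫ ψ dμ` is a multiple of it. -/
theorem exists_integral_symIntegrand_eq (hn : IsNice μ C₀) {z₀ : ℂ} (hz₀ : z₀ ∉ μ.support)
    (h : ∀ ψ ∈ TestClass μ, ∃ φ : ℂ → ℂ, IsCutoff φ ψ ∧ onePairing μ z₀ φ ψ = 0) :
    ∃ lam : ℂ, ∀ ψ : ℂ → ℂ, IsLipCompact ψ →
      ∫ p, symIntegrand z₀ ψ p ∂(μ.prod μ) = lam * ∫ z, ψ z ∂μ := by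
  have := hn.isLocallyFiniteMeasure
  by_cases hex : ∃ ψ₀ : ℂ → ℂ, IsLipCompact ψ₀ ∧ ∫ z, ψ₀ z ∂μ ≠ 0
  · obtain ⟨ψ₀, hψ₀, hne⟩ := hex
    refine ⟨(∫ p, symIntegrand z₀ ψ₀ p ∂(μ.prod μ)) / ∫ z, ψ₀ z ∂μ, fun ψ hψ => ?_⟩
    set c : ℂ := (∫ z, ψ z ∂μ) / ∫ z, ψ₀ z ∂μ with hc
    have h1 := integral_symIntegrand_eq_zero hn hz₀ h (hψ.sub (hψ₀.const_mul c)) (by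
      rw [integral_sub (hψ.integrable μ) ((hψ₀.const_mul c).integrable μ), integral_const_mul, hc]
      field_simp
      ring)
    simp only [symIntegrand_sub, symIntegrand_const_mul] at h1
    rw [integral_sub (integrable_symIntegrand hn hz₀ hψ)
      ((integrable_symIntegrand hn hz₀ hψ₀).const_mul c), integral_const_mul, sub_eq_zero] at h1
    rw [h1, hc]
    ring
  · push Not at hex
    refine ⟨0, fun ψ hψ => ?_⟩
    rw [zero_mul, integral_symIntegrand_eq_zero hn hz₀ h hψ (hex ψ hψ)]

end Symmetrization

/-! ### The quadratic equation for the renormalized transform. -/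

section QuadraticIdentity

variable {μ : Measure ℂ} {C₀ : ℝ}

/-- The Cauchy transform of `μ`, renormalized so as to vanish at `z₀`. -/
def renormTransform (μ : Measure ℂ) (z₀ w : ℂ) : ℂ :=
  ∫ ξ, (kernel (w - ξ) - kernel (z₀ - ξ)) ∂μ

theorem regKernel_eq_kernel {δ : ℝ} {z : ℂ} (hδ : 0 < δ) (hz : δ ≤ ‖z‖) :
    regKernel δ z = kernel z := by
  have hz0 : z ≠ 0 := norm_pos_iff.1 (hδ.trans_le hz)
  have hc : (starRingEnd ℂ) z ≠ 0 := by simpa using hz0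
  rw [regKernel, kernel, max_eq_right hz, ← Complex.conj_mul']
  field_simp

theorem norm_regKernel_le {δ : ℝ} (hδ : 0 < δ) (z : ℂ) : ‖regKernel δ z‖ ≤ δ⁻¹ := by
  have hm : 0 < max δ ‖z‖ := lt_max_of_lt_left hδ
  rw [regKernel, norm_div, norm_pow, Complex.norm_real, Real.norm_of_nonneg hm.le,
    RCLike.norm_conj, div_le_iff₀ (by positivity), sq, ← mul_assoc]
  calc ‖z‖ ≤ 1 * max δ ‖z‖ := by rw [one_mul]; exact le_max_right _ _
    _ ≤ _ := by
      gcongr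
      rw [← div_eq_inv_mul, one_le_div hδ]
      exact le_max_left _ _

/-- The regularized kernel serves here as a globally Lipschitz extension of `K` from outside a disc,
so that it yields admissible test functions. -/
theorem norm_regKernel_sub_le {δ : ℝ} (hδ : 0 < δ) (z w : ℂ) :
    ‖regKernel δ z - regKernel δ w‖ ≤ 3 / δ ^ 2 * ‖z - w‖ := by
  set a := max δ ‖z‖ with ha
  set b := max δ ‖w‖ with hb
  have ha0 : 0 < a := lt_max_of_lt_left hδ
  have hb0 : 0 < b := lt_max_of_lt_left hδ
  have haC : (a : ℂ) ≠ 0 := by exact_mod_cast ha0.ne'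
  have hbC : (b : ℂ) ≠ 0 := by exact_mod_cast hb0.ne'
  have hab : |b - a| ≤ ‖z - w‖ := by
    have := abs_max_sub_max_le_max δ ‖w‖ δ ‖z‖
    rw [sub_self, abs_zero, max_eq_right (abs_nonneg (‖w‖ - ‖z‖))] at this
    exact this.trans (by rw [norm_sub_rev]; exact abs_norm_sub_norm_le _ _)
  have hδab : δ ^ 2 ≤ a * b := by
    rw [sq]
    exact mul_le_mul (le_max_left _ _) (le_max_left _ _) hδ.le ha0.le
  have hid : regKernel δ z - regKernel δ w
      = (starRingEnd ℂ (z - w) + (starRingEnd ℂ z / a) * ((b - a : ℝ) : ℂ)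
        + (starRingEnd ℂ w / b) * ((b - a : ℝ) : ℂ)) / ((a * b : ℝ) : ℂ) := by
    rw [regKernel, regKernel, ← ha, ← hb, map_sub]
    push_cast
    field_simp
    ring
  have hz1 : ‖starRingEnd ℂ z / a‖ ≤ 1 := by
    rw [norm_div, RCLike.norm_conj, Complex.norm_real, Real.norm_of_nonneg ha0.le, div_le_one ha0]
    exact le_max_right _ _
  have hw1 : ‖starRingEnd ℂ w / b‖ ≤ 1 := by
    rw [norm_div, RCLike.norm_conj, Complex.norm_real, Real.norm_of_nonneg hb0.le, div_le_one hb0]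
    exact le_max_right _ _
  have hba : ‖((b - a : ℝ) : ℂ)‖ ≤ ‖z - w‖ := by rwa [Complex.norm_real, Real.norm_eq_abs]
  have hnum : ‖starRingEnd ℂ (z - w) + (starRingEnd ℂ z / a) * ((b - a : ℝ) : ℂ)
        + (starRingEnd ℂ w / b) * ((b - a : ℝ) : ℂ)‖ ≤ 3 * ‖z - w‖ := by
    refine (norm_add₃_le).trans ?_
    rw [norm_mul, norm_mul, RCLike.norm_conj]
    have h1 := mul_le_mul hz1 hba (norm_nonneg _) zero_le_one
    have h2 := mul_le_mul hw1 hba (norm_nonneg _) zero_le_one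
    linarith
  rw [hid, norm_div, Complex.norm_real, Real.norm_of_nonneg (by positivity), div_mul_eq_mul_div 3]
  exact div_le_div₀ (by positivity) hnum (by positivity) hδab

theorem abs_tent_sub_mul_norm_le {R : ℝ} (hR : 0 < R) (z ξ : ℂ) :
    |tent R z - tent R ξ| * ‖ξ‖ ≤ ‖z - ξ‖ := by
  have h1 : ‖ξ‖ - ‖z‖ ≤ ‖z - ξ‖ := by
    rw [norm_sub_rev]
    exact norm_sub_norm_le _ _
  have h0 := norm_nonneg z
  by_cases hξ : ‖ξ‖ ≤ R
  · refine (mul_le_mul_of_nonneg_right (abs_tent_sub_le hR z ξ) (norm_nonneg _)).trans ?_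
    rw [div_mul_eq_mul_div, div_le_iff₀ hR]
    gcongr
  · rw [tent_eq_zero hR (not_le.1 hξ).le, sub_zero, abs_of_nonneg (tent_nonneg _ _), tent,
      max_mul_of_nonneg _ _ (norm_nonneg _), zero_mul]
    refine max_le (norm_nonneg _) (le_trans ?_ h1)
    have : ‖z‖ * 1 ≤ ‖z‖ * (‖ξ‖ / R) := by
      gcongr
      rw [one_le_div hR]
      exact (not_le.1 hξ).le
    calc (1 - ‖z‖ / R) * ‖ξ‖ = ‖ξ‖ - ‖z‖ * (‖ξ‖ / R) := by ring
      _ ≤ _ := by linarith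

/-- The bound is uniform in `R`. The factor `‖z - ξ‖` will absorb the kernel singularity, and the
remaining decay, naturally that of the larger variable, is shared evenly so that each variable
becomes integrable. -/
theorem abs_tent_sub_le_rpow {R : ℝ} (hR : 1 ≤ R) (z ξ : ℂ) :
    |tent R z - tent R ξ| ≤
      2 * ‖z - ξ‖ * ((1 + ‖z‖) ^ (-(1 / 2) : ℝ) * (1 + ‖ξ‖) ^ (-(1 / 2) : ℝ)) := by
  have key : ∀ z ξ : ℂ, ‖z‖ ≤ ‖ξ‖ → |tent R z - tent R ξ| ≤
      2 * ‖z - ξ‖ * ((1 + ‖z‖) ^ (-(1 / 2) : ℝ) * (1 + ‖ξ‖) ^ (-(1 / 2) : ℝ)) := by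
    intro z ξ h
    have h1 := abs_tent_sub_mul_norm_le (one_pos.trans_le hR) z ξ
    have h2 : |tent R z - tent R ξ| ≤ ‖z - ξ‖ :=
      (abs_tent_sub_le (one_pos.trans_le hR) z ξ).trans (div_le_self (norm_nonneg _) hR)
    have h3 : |tent R z - tent R ξ| ≤ 2 * ‖z - ξ‖ * (1 + ‖ξ‖)⁻¹ := by
      rw [← div_eq_mul_inv, le_div_iff₀ (by positivity)]
      linarith
    refine h3.trans ?_
    gcongr
    calc (1 + ‖ξ‖)⁻¹ = (1 + ‖ξ‖) ^ (-(1 / 2) : ℝ) * (1 + ‖ξ‖) ^ (-(1 / 2) : ℝ) := by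
          rw [← Real.rpow_add (by positivity), ← Real.rpow_neg_one]
          norm_num
      _ ≤ _ := by
        refine mul_le_mul_of_nonneg_right ?_ (by positivity)
        exact Real.rpow_le_rpow_of_nonpos (by positivity) (by linarith) (by norm_num)
  rcases le_total ‖z‖ ‖ξ‖ with h | h
  · exact key z ξ h
  · have := key ξ z h
    rw [abs_sub_comm, norm_sub_rev, mul_comm ((1 + ‖ξ‖) ^ _)] at this
    exact this

theorem tendsto_tent (z : ℂ) :
    Filter.Tendsto (fun n : ℕ => tent (n + 1) z) Filter.atTop (𝓝 1) := by
  have h1 : Filter.Tendsto (fun n : ℕ => ‖z‖ / ((n : ℝ) + 1)) Filter.atTop (𝓝 0) := by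
    have := (tendsto_one_div_add_atTop_nhds_zero_nat (𝕜 := ℝ)).const_mul ‖z‖
    simpa [div_eq_mul_inv] using this
  have h2 : Filter.Tendsto (fun n : ℕ => max 0 (1 - ‖z‖ / ((n : ℝ) + 1))) Filter.atTop
      (𝓝 (max 0 (1 - 0))) := tendsto_const_nhds.max (tendsto_const_nhds.sub h1)
  simpa [tent] using h2

/-- For `a = b = 1` this says that the symmetrized integrand of `g(ξ) = K(w - ξ) - K(z₀ - ξ)` is `½
g(z) g(ξ)`. Truncation costs an error proportional to `a - b`, written as a product so that its
decay in `z` can be read off. -/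
theorem symIntegrand_tent_mul {w z₀ z ξ : ℂ} (hwz : w - z ≠ 0) (hwξ : w - ξ ≠ 0)
    (hz : z₀ - z ≠ 0) (hξ : z₀ - ξ ≠ 0) (hzξ : z - ξ ≠ 0) (a b : ℂ) :
    (1 / 2) * (a * (kernel (w - z) - kernel (z₀ - z)) * (kernel (z - ξ) - kernel (z₀ - ξ))
      + b * (kernel (w - ξ) - kernel (z₀ - ξ)) * (kernel (ξ - z) - kernel (z₀ - z)))
    = (1 / 2) * (a * ((kernel (w - z) - kernel (z₀ - z)) * (kernel (w - ξ) - kernel (z₀ - ξ))))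
      + (1 / 2) * ((a - b) * (kernel (w - ξ) - kernel (z₀ - ξ))
        * ((ξ - z₀) * kernel (z - ξ) * kernel (z - z₀))) := by
  have h1 : kernel (w - z) - kernel (w - ξ) = (z - ξ) * (kernel (w - z) * kernel (w - ξ)) := by
    rw [kernel_sub_kernel hwz hwξ]; ring
  have h2 : kernel (z₀ - z) - kernel (z₀ - ξ) = (z - ξ) * (kernel (z₀ - z) * kernel (z₀ - ξ)) := by
    rw [kernel_sub_kernel hz hξ]; ring
  have hz' : z - z₀ ≠ 0 := by rw [← neg_sub]; exact neg_ne_zero.2 hz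
  have h3 : (ξ - z₀) * kernel (z - ξ) * kernel (z - z₀) = kernel (z - ξ) - kernel (z - z₀) := by
    rw [kernel_sub_kernel hzξ hz']; ring
  have h4 : kernel (z - ξ) * (z - ξ) = 1 := by rw [kernel]; field_simp
  rw [h3, kernel_sub_comm z ξ, kernel_sub_comm z₀ z]
  linear_combination (1 / 2 : ℂ) * a * kernel (z - ξ) * (h1 - h2) +
    (1 / 2 : ℂ) * a * (kernel (w - z) * kernel (w - ξ) - kernel (z₀ - z) * kernel (z₀ - ξ)) * h4

theorem integrable_kernel_sub (hn : IsNice μ C₀) {z₀ w : ℂ} (hz₀ : z₀ ∉ μ.support)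
    (hw : w ∉ μ.support) : Integrable (fun ξ => kernel (w - ξ) - kernel (z₀ - ξ)) μ := by
  obtain ⟨A, -, hA⟩ := exists_one_add_norm_le μ.isClosed_support hz₀
  obtain ⟨B, -, hB⟩ := exists_one_add_norm_le μ.isClosed_support hw
  refine ((hn.integrable_one_add_norm_rpow (by norm_num : (1 : ℝ) < 2)).const_mul
    (‖z₀ - w‖ * (B * A))).mono' (Measurable.aestronglyMeasurable (by fun_prop)) ?_
  filter_upwards [ae_mem_support μ] with ξ hξ
  exact norm_kernel_sub_kernel_le (hB ξ hξ) (hA ξ hξ)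

theorem continuousAt_renormTransform (hn : IsNice μ C₀) {z₀ w : ℂ} (hz₀ : z₀ ∉ μ.support)
    (hw : w ∉ μ.support) : ContinuousAt (renormTransform μ z₀) w := by
  obtain ⟨A, hA0, hA⟩ := exists_one_add_norm_le μ.isClosed_support hz₀
  obtain ⟨B, hB0, hB⟩ := eventually_one_add_norm_le μ.isClosed_support hw
  refine continuousAt_of_dominated
    (bound := fun ξ => ((‖z₀ - w‖ + 1) * (B * A)) * (1 + ‖ξ‖) ^ (-2 : ℝ))
    (.of_forall fun v => Measurable.aestronglyMeasurable (by fun_prop)) ?_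
    ((hn.integrable_one_add_norm_rpow (by norm_num : (1 : ℝ) < 2)).const_mul _) ?_
  · have hlim : ∀ᶠ v in 𝓝 w, ‖z₀ - v‖ < ‖z₀ - w‖ + 1 :=
      (by fun_prop : Continuous fun v => ‖z₀ - v‖).continuousAt.eventually_lt_const
        (lt_add_one _)
    filter_upwards [hB, hlim] with v hv hv'
    filter_upwards [ae_mem_support μ] with ξ hξ
    refine (norm_kernel_sub_kernel_le (hv ξ hξ) (hA ξ hξ)).trans ?_
    gcongr
  · filter_upwards [ae_mem_support μ] with ξ hξ
    have h0 : w - ξ ≠ 0 := ne_of_one_add_norm_le (hB.self_of_nhds ξ hξ)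
    unfold kernel
    fun_prop (disch := exact h0)

theorem isLipCompact_tent_mul {R : ℝ} (hR : 0 < R) {f : ℂ → ℂ} {M B : ℝ}
    (hM : ∀ z w, ‖f z - f w‖ ≤ M * ‖z - w‖) (hB : ∀ z, ‖f z‖ ≤ B) :
    IsLipCompact fun z => (tent R z : ℂ) * f z := by
  have hB0 : 0 ≤ B := (norm_nonneg _).trans (hB 0)
  have hM0 : 0 ≤ M := by simpa using (norm_nonneg _).trans (hM 1 0)
  refine ⟨⟨(M + B / R).toNNReal, LipschitzWith.of_dist_le_mul fun z w => ?_⟩, ?_⟩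
  · rw [dist_eq_norm, dist_eq_norm, Real.coe_toNNReal _ (by positivity)]
    have h1 : (tent R z : ℂ) * f z - tent R w * f w
        = tent R z * (f z - f w) + ((tent R z - tent R w : ℝ) : ℂ) * f w := by
      push_cast
      ring
    rw [h1]
    refine (norm_add_le _ _).trans ?_
    rw [norm_mul, norm_mul, Complex.norm_real, Complex.norm_real,
      Real.norm_of_nonneg (tent_nonneg _ _), Real.norm_eq_abs]
    calc _ ≤ 1 * (M * ‖z - w‖) + (‖z - w‖ / R) * B := by
          gcongr
          · exact tent_le_one hR z
          · exact hM z w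
          · exact abs_tent_sub_le hR z w
          · exact hB w
      _ = _ := by ring
  · exact HasCompactSupport.mul_right ((hasCompactSupport_tent hR).comp_left Complex.ofReal_zero)

theorem renormTransform_sq (hn : IsNice μ C₀) {z₀ w lam : ℂ} (hz₀ : z₀ ∉ μ.support)
    (hw : w ∉ μ.support)
    (hlam : ∀ ψ : ℂ → ℂ, IsLipCompact ψ →
      ∫ p, symIntegrand z₀ ψ p ∂(μ.prod μ) = lam * ∫ z, ψ z ∂μ) :
    (1 / 2) * renormTransform μ z₀ w ^ 2 = lam * renormTransform μ z₀ w := by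
  have := hn.isLocallyFiniteMeasure
  have := hn.nullSingletonClass
  obtain ⟨A, hA0, hA⟩ := exists_one_add_norm_le μ.isClosed_support hz₀
  obtain ⟨B, hB0, hB⟩ := exists_one_add_norm_le μ.isClosed_support hw
  -- At most the distance from either pole to the support, so on the support the regularized kernels
  -- agree with the true ones.
  set δ : ℝ := min A⁻¹ B⁻¹ with hδdef
  have hδ : 0 < δ := by positivity
  have far : ∀ {D : ℝ}, 0 < D → ∀ {v ξ : ℂ}, 1 + ‖ξ‖ ≤ D * ‖v - ξ‖ → D⁻¹ ≤ ‖v - ξ‖ := by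
    intro D hD v ξ h
    rw [inv_le_iff_one_le_mul₀ hD]
    linarith [norm_nonneg ξ]
  set g : ℂ → ℂ := fun ξ => kernel (w - ξ) - kernel (z₀ - ξ) with hg
  set ψ : ℕ → ℂ → ℂ := fun n ξ => (tent (n + 1) ξ : ℂ) *
    (regKernel δ (w - ξ) - regKernel δ (z₀ - ξ)) with hψ
  have hψE : ∀ n, ∀ ξ ∈ μ.support, ψ n ξ = (tent (n + 1) ξ : ℂ) * g ξ := by
    intro n ξ hξ
    simp only [hψ, hg]
    rw [regKernel_eq_kernel hδ ((min_le_right _ _).trans (far hB0 (hB ξ hξ))),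
      regKernel_eq_kernel hδ ((min_le_left _ _).trans (far hA0 (hA ξ hξ)))]
  have hψL : ∀ n, IsLipCompact (ψ n) := by
    intro n
    refine isLipCompact_tent_mul (by positivity) (M := 3 / δ ^ 2 + 3 / δ ^ 2) (B := δ⁻¹ + δ⁻¹)
      (fun z v => ?_) fun z => (norm_sub_le _ _).trans
        (add_le_add (norm_regKernel_le hδ _) (norm_regKernel_le hδ _))
    have h1 := norm_regKernel_sub_le hδ (w - z) (w - v)
    have h2 := norm_regKernel_sub_le hδ (z₀ - z) (z₀ - v)
    rw [sub_sub_sub_cancel_left, norm_sub_rev v z] at h1 h2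
    rw [sub_sub_sub_comm, add_mul]
    exact (norm_sub_le _ _).trans (add_le_add h1 h2)
  have hgint : Integrable g μ := integrable_kernel_sub hn hz₀ hw
  have hgn : ∀ ξ ∈ μ.support, ‖g ξ‖ ≤ ‖z₀ - w‖ * (B * A) * (1 + ‖ξ‖) ^ (-2 : ℝ) :=
    fun ξ hξ => norm_kernel_sub_kernel_le (hB ξ hξ) (hA ξ hξ)
  set D : ℝ := ‖z₀ - w‖ * (B * A) with hD
  have hD0 : 0 ≤ D := by positivity
  have hlim1 : Filter.Tendsto (fun n => ∫ z, ψ n z ∂μ) Filter.atTop (𝓝 (∫ z, g z ∂μ)) := by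
    refine tendsto_integral_of_dominated_convergence (fun ξ => ‖g ξ‖)
      (fun n => (hψL n).continuous.aestronglyMeasurable) hgint.norm (fun n => ?_) ?_
    · filter_upwards [ae_mem_support μ] with ξ hξ
      rw [hψE n ξ hξ, norm_mul, Complex.norm_real, Real.norm_of_nonneg (tent_nonneg _ _)]
      exact mul_le_of_le_one_left (norm_nonneg _) (tent_le_one (by positivity) _)
    · filter_upwards [ae_mem_support μ] with ξ hξ
      simp only [hψE _ ξ hξ]
      have := (Complex.continuous_ofReal.tendsto _).comp (tendsto_tent ξ)
      simpa using this.mul_const (g ξ)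
  have hS : ∀ n, ∀ p : ℂ × ℂ, p.1 ∈ μ.support → p.2 ∈ μ.support → p.1 ≠ p.2 →
      symIntegrand z₀ (ψ n) p = (1 / 2) * ((tent (n + 1) p.1 : ℂ) * (g p.1 * g p.2))
        + (1 / 2) * (((tent (n + 1) p.1 : ℂ) - tent (n + 1) p.2) * g p.2
          * ((p.2 - z₀) * kernel (p.1 - p.2) * kernel (p.1 - z₀))) := by
    intro n p h1 h2 hne
    rw [symIntegrand, hψE n _ h1, hψE n _ h2]
    exact symIntegrand_tent_mul (ne_of_one_add_norm_le (hB _ h1)) (ne_of_one_add_norm_le (hB _ h2))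
      (ne_of_one_add_norm_le (hA _ h1)) (ne_of_one_add_norm_le (hA _ h2)) (sub_ne_zero.2 hne) _ _
  have hlim2 : Filter.Tendsto (fun n => ∫ p, symIntegrand z₀ (ψ n) p ∂(μ.prod μ)) Filter.atTop
      (𝓝 (∫ p, (1 / 2) * (g p.1 * g p.2) ∂(μ.prod μ))) := by
    set C : ℝ := D * D + D * ((1 + ‖z₀‖) * A) with hC
    have hwt := hn.integrable_one_add_norm_rpow (by norm_num : (1 : ℝ) < 3 / 2)
    refine tendsto_integral_of_dominated_convergence
      (fun p => C * ((1 + ‖p.1‖) ^ (-(3 / 2) : ℝ) * (1 + ‖p.2‖) ^ (-(3 / 2) : ℝ)))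
      (fun n => (integrable_symIntegrand hn hz₀ (hψL n)).aestronglyMeasurable)
      ((hwt.mul_prod hwt).const_mul C) (fun n => ?_) ?_
    · filter_upwards [ae_prod_mem_support μ, ae_prod_ne μ μ] with p hp hne
      rw [hS n p hp.1 hp.2 hne]
      have hx : 1 ≤ 1 + ‖p.1‖ := by simp
      have hy : 1 ≤ 1 + ‖p.2‖ := by simp
      have hg1 := hgn _ hp.1
      have hg2 := hgn _ hp.2
      have ht := abs_tent_sub_le_rpow (R := n + 1) (by simp) p.1 p.2
      have hk := norm_kernel_le (hA _ hp.1)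
      have hz2 : ‖p.2 - z₀‖ ≤ (1 + ‖z₀‖) * (1 + ‖p.2‖) := by
        refine (norm_sub_le _ _).trans ?_
        nlinarith [norm_nonneg p.2, norm_nonneg z₀]
      set x : ℝ := 1 + ‖p.1‖ with hxdef
      set y : ℝ := 1 + ‖p.2‖ with hydef
      have hx0 : 0 < x := one_pos.trans_le hx
      have hy0 : 0 < y := one_pos.trans_le hy
      have hd0 : 0 < ‖p.1 - p.2‖ := norm_pos_iff.2 (sub_ne_zero.2 hne)
      have hpow : ∀ t : ℝ, 1 ≤ t → t ^ (-2 : ℝ) ≤ t ^ (-(3 / 2) : ℝ) := fun t ht =>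
        Real.rpow_le_rpow_of_exponent_le ht (by norm_num)
      have e1 : ‖(1 / 2 : ℂ) * ((tent (n + 1) p.1 : ℂ) * (g p.1 * g p.2))‖
          ≤ D * D * (x ^ (-(3 / 2) : ℝ) * y ^ (-(3 / 2) : ℝ)) := by
        rw [norm_mul, norm_mul, norm_mul, Complex.norm_real,
          Real.norm_of_nonneg (tent_nonneg _ _)]
        have ht0 := tent_nonneg ((n : ℝ) + 1) p.1
        have hg1' := hg1.trans (mul_le_mul_of_nonneg_left (hpow x hx) hD0)
        have hg2' := hg2.trans (mul_le_mul_of_nonneg_left (hpow y hy) hD0)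
        calc _ ≤ 1 * (1 * ((D * x ^ (-(3 / 2) : ℝ)) * (D * y ^ (-(3 / 2) : ℝ)))) := by
              gcongr
              · norm_num
              · exact tent_le_one (by positivity) _
          _ = _ := by ring
      have e2 : ‖(1 / 2 : ℂ) * (((tent (n + 1) p.1 : ℂ) - tent (n + 1) p.2) * g p.2
          * ((p.2 - z₀) * kernel (p.1 - p.2) * kernel (p.1 - z₀)))‖
          ≤ D * ((1 + ‖z₀‖) * A) * (x ^ (-(3 / 2) : ℝ) * y ^ (-(3 / 2) : ℝ)) := by
        rw [kernel_sub_comm z₀ p.1, ← Complex.ofReal_sub]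
        simp only [norm_mul, norm_neg, Complex.norm_real, Real.norm_eq_abs]
        rw [norm_kernel (p.1 - p.2)]
        -- The tent difference cancels `‖p.1 - p.2‖⁻¹`; the exponents add to `-1 - 1/2` for `x` and
        -- `-2 + 1 - 1/2` for `y`, both `-3/2`.
        calc _ ≤ (1 / 2) * ((2 * ‖p.1 - p.2‖ * (x ^ (-(1 / 2) : ℝ) * y ^ (-(1 / 2) : ℝ)))
              * (D * y ^ (-2 : ℝ)) * (((1 + ‖z₀‖) * y) * ‖p.1 - p.2‖⁻¹ * (A * x⁻¹))) := by
              gcongr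
              norm_num
          _ = D * ((1 + ‖z₀‖) * A) * ((x⁻¹ * x ^ (-(1 / 2) : ℝ)) *
              (y ^ (-2 : ℝ) * y * y ^ (-(1 / 2) : ℝ))) := by
              field_simp
          _ = _ := by
              congr 2
              · rw [← Real.rpow_neg_one, ← Real.rpow_add hx0]
                norm_num
              · nth_rewrite 2 [← Real.rpow_one y]
                rw [← Real.rpow_add hy0, ← Real.rpow_add hy0]
                norm_num
      rw [hC, add_mul]
      exact (norm_add_le _ _).trans (add_le_add e1 e2)
    · filter_upwards [ae_prod_mem_support μ, ae_prod_ne μ μ] with p hp hne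
      simp only [hS _ p hp.1 hp.2 hne]
      have t1 := (Complex.continuous_ofReal.tendsto _).comp (tendsto_tent p.1)
      have t2 := (Complex.continuous_ofReal.tendsto _).comp (tendsto_tent p.2)
      have t3 := ((t1.mul_const (g p.1 * g p.2)).const_mul (1 / 2 : ℂ)).add
        ((((t1.sub t2).mul_const (g p.2)).mul_const
          ((p.2 - z₀) * kernel (p.1 - p.2) * kernel (p.1 - z₀))).const_mul (1 / 2 : ℂ))
      simpa using t3
  have hlim3 := hlim1.const_mul lam
  simp only [← hlam _ (hψL _)] at hlim3
  have heq := tendsto_nhds_unique hlim2 hlim3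
  rw [integral_const_mul, integral_prod_mul g g, ← sq] at heq
  exact heq

end QuadraticIdentity

/-! ### Divergence theorem on half-planes and the Cauchy–Pompeiu formula. -/

section CauchyPompeiu

/-- The Cauchy–Riemann derivative `∂F/∂z̄` of a real-valued function. -/
def dbar (F : ℂ → ℝ) (w : ℂ) : ℂ :=
  (1 / 2) * ((fderiv ℝ F w 1 : ℂ) + Complex.I * (fderiv ℝ F w Complex.I : ℂ))

variable {F : ℂ → ℝ}

theorem hasDerivAt_comp_line (hF : ContDiff ℝ 1 F) (a u : ℂ) (r : ℝ) :
    HasDerivAt (fun r : ℝ => F (a + r * u)) (fderiv ℝ F (a + r * u) u) r := by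
  have h1 : HasDerivAt (fun r : ℝ => a + (r : ℂ) * u) u r := by
    simpa using ((Complex.ofRealCLM.hasDerivAt (x := r)).mul_const u).const_add a
  exact (hF.differentiable one_ne_zero _).hasFDerivAt.comp_hasDerivAt r h1

theorem integral_Ioi_fderiv_line (hF : ContDiff ℝ 1 F) (hc : HasCompactSupport F) (a : ℂ) {u : ℂ}
    (hu : u ≠ 0) (b : ℝ) :
    ∫ r in Set.Ioi b, fderiv ℝ F (a + r * u) u = -F (a + b * u) := by
  have hcd : ContDiff ℝ 1 (fun r : ℝ => F (a + r * u)) := by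
    refine hF.comp (contDiff_const.add (ContDiff.mul ?_ contDiff_const))
    exact Complex.ofRealCLM.contDiff
  have hcs : HasCompactSupport (fun r : ℝ => F (a + r * u)) := by
    obtain ⟨R, hR⟩ := hc.isCompact.isBounded.exists_norm_le
    refine HasCompactSupport.intro (isCompact_closedBall (0 : ℝ) ((R + ‖a‖) / ‖u‖)) fun r hr => ?_
    by_contra hne
    refine hr ?_
    have h1 := hR _ (subset_tsupport _ (Function.mem_support.2 hne))
    rw [mem_closedBall_zero_iff, le_div_iff₀ (norm_pos_iff.2 hu), ← Complex.norm_real, ← norm_mul]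
    have h2 := norm_sub_le (a + r * u) a
    rw [add_sub_cancel_left] at h2
    linarith
  rw [← hcs.integral_Ioi_deriv_eq hcd b]
  exact integral_congr_ae (.of_forall fun r => (hasDerivAt_comp_line hF a u r).deriv.symm)

theorem continuous_fderiv_apply_comp (hF : ContDiff ℝ 1 F) {X : Type*} [TopologicalSpace X]
    {f g : X → ℂ} (hf : Continuous f) (hg : Continuous g) :
    Continuous fun x => fderiv ℝ F (f x) (g x) :=
  ((hF.continuous_fderiv one_ne_zero).comp hf).clm_apply hg

theorem fderiv_eq_zero_of_lt_norm {R : ℝ} (hR : ∀ z ∈ tsupport F, ‖z‖ ≤ R) {z : ℂ}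
    (hz : R < ‖z‖) : fderiv ℝ F z = 0 :=
  image_eq_zero_of_notMem_tsupport fun h =>
    (hR z (tsupport_fderiv_subset ℝ h)).not_gt hz

/-- `conj ρ` is the unit inward normal. Rotating it to the real axis reduces the integral, by
Fubini, to the fundamental theorem of calculus on each normal ray. -/
theorem integral_halfPlane_fderiv (hF : ContDiff ℝ 1 F) (hc : HasCompactSupport F) {ρ : ℂ}
    (hρ : ‖ρ‖ = 1) (b : ℝ) :
    ∫ y in {y : ℂ | b < (ρ * y).re}, fderiv ℝ F y (starRingEnd ℂ ρ)
      = -∫ t : ℝ, F (starRingEnd ℂ ρ * (b + t * Complex.I)) := by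
  set u : ℂ := starRingEnd ℂ ρ with hu
  have hun : ‖u‖ = 1 := by rw [hu, RCLike.norm_conj, hρ]
  have hu0 : u ≠ 0 := norm_pos_iff.1 (by rw [hun]; exact one_pos)
  have hρu : ρ * u = 1 := by
    rw [hu, Complex.mul_conj, Complex.normSq_eq_norm_sq, hρ]
    norm_num
  set e : ℂ ≃ₗᵢ[ℝ] ℂ := rotation ⟨u, mem_sphere_zero_iff_norm.2 hun⟩ with he
  have hea : ∀ z, e z = u * z := fun z => rotation_apply _ z
  have hmp := e.measurePreserving.comp Complex.volume_preserving_equiv_real_prod.symm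
  have hemb : MeasurableEmbedding (e ∘ Complex.measurableEquivRealProd.symm) :=
    e.toHomeomorph.measurableEmbedding.comp
      Complex.measurableEquivRealProd.symm.measurableEmbedding
  have happ : ∀ p : ℝ × ℝ, (e ∘ Complex.measurableEquivRealProd.symm) p
      = u * (p.2 * Complex.I) + p.1 * u := by
    intro p
    rw [Function.comp_apply, hea, Complex.measurableEquivRealProd_symm_apply,
      Complex.mk_eq_add_mul_I]
    ring
  have hpre : (e ∘ Complex.measurableEquivRealProd.symm) ⁻¹' {y : ℂ | b < (ρ * y).re}
      = Set.Ioi b ×ˢ Set.univ := by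
    ext p
    simp only [Set.mem_preimage, happ]
    change b < (ρ * (u * (p.2 * Complex.I) + p.1 * u)).re ↔ _
    rw [show ρ * (u * (p.2 * Complex.I) + p.1 * u) = (ρ * u) * (p.1 + p.2 * Complex.I) by ring, hρu]
    simp
  rw [← hmp.setIntegral_preimage_emb hemb, hpre]
  simp only [happ]
  have hint : Integrable (fun p : ℝ × ℝ => fderiv ℝ F (u * (p.2 * Complex.I) + p.1 * u) u) := by
    refine Continuous.integrable_of_hasCompactSupport
      (continuous_fderiv_apply_comp hF (by fun_prop) continuous_const) ?_
    obtain ⟨R, hR⟩ := hc.isCompact.isBounded.exists_norm_le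
    refine HasCompactSupport.intro (isCompact_closedBall (0 : ℝ × ℝ) R) fun p hp => ?_
    have hlt : R < ‖u * (p.2 * Complex.I) + p.1 * u‖ := by
      rw [mem_closedBall_zero_iff, not_le] at hp
      refine hp.trans_le ?_
      rw [show u * (p.2 * Complex.I) + p.1 * u = u * (p.1 + p.2 * Complex.I) by ring, norm_mul, hun,
        one_mul, Prod.norm_def]
      have h1 := Complex.abs_re_le_norm (p.1 + p.2 * Complex.I)
      have h2 := Complex.abs_im_le_norm (p.1 + p.2 * Complex.I)
      simp only [Complex.add_re, Complex.ofReal_re, Complex.mul_re, Complex.I_re, mul_zero,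
        Complex.ofReal_im, Complex.I_im, mul_one, sub_self, add_zero, Complex.add_im,
        Complex.mul_im, zero_add] at h1 h2
      exact max_le h1 h2
    rw [fderiv_eq_zero_of_lt_norm hR hlt]
    rfl
  have hres : (volume : Measure (ℝ × ℝ)).restrict (Set.Ioi b ×ˢ Set.univ)
      = (volume.restrict (Set.Ioi b)).prod volume := by
    rw [Measure.volume_eq_prod, ← Measure.prod_restrict, Measure.restrict_univ]
  have hint' := hint.restrict (s := Set.Ioi b ×ˢ Set.univ)
  rw [hres] at hint' ⊢
  rw [integral_prod_symm _ hint', ← integral_neg]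
  refine integral_congr_ae (.of_forall fun t => ?_)
  simp only
  rw [integral_Ioi_fderiv_line hF hc _ hu0]
  congr 2
  ring

/-- Apply the half-plane formula to a half-plane whose interior contains the support of `F`: the
boundary term vanishes. -/
theorem integral_fderiv_eq_zero (hF : ContDiff ℝ 1 F) (hc : HasCompactSupport F) {u : ℂ}
    (hu : ‖u‖ = 1) : ∫ y, fderiv ℝ F y u = 0 := by
  obtain ⟨R, hR⟩ := hc.isCompact.isBounded.exists_norm_le
  have hρ : ‖starRingEnd ℂ u‖ = 1 := by rw [RCLike.norm_conj, hu]
  have h := integral_halfPlane_fderiv hF hc hρ (-(|R| + 1))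
  have hle := le_abs_self R
  rw [Complex.conj_conj] at h
  rw [setIntegral_eq_integral_of_forall_compl_eq_zero] at h
  · rw [h, neg_eq_zero]
    refine integral_eq_zero_of_ae (.of_forall fun t => image_eq_zero_of_notMem_tsupport fun ht => ?_)
    have h1 := hR _ ht
    rw [norm_mul, hu, one_mul] at h1
    have h2 := Complex.abs_re_le_norm (((-(|R| + 1) : ℝ) : ℂ) + t * Complex.I)
    simp only [Complex.add_re, Complex.ofReal_re, Complex.mul_re, Complex.I_re, mul_zero,
      Complex.ofReal_im, Complex.I_im, mul_one, sub_self, add_zero, abs_neg] at h2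
    rw [abs_of_pos (by positivity)] at h2
    linarith
  · intro y hy
    have h1 : (starRingEnd ℂ u * y).re ≤ -(|R| + 1) := not_lt.1 hy
    have h2 : |R| + 1 ≤ ‖y‖ := by
      have h3 := Complex.abs_re_le_norm (starRingEnd ℂ u * y)
      rw [norm_mul, hρ, one_mul] at h3
      have := neg_le_abs (starRingEnd ℂ u * y).re
      linarith
    rw [fderiv_eq_zero_of_lt_norm hR (by linarith)]
    rfl

/-- The Cauchy–Riemann operator in the rotated frame `u, iu`, needed for polar coordinates. -/
theorem inv_mul_dbar {u : ℂ} (hu : ‖u‖ = 1) (z : ℂ) : u⁻¹ * dbar F z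
    = (1 / 2) * ((fderiv ℝ F z u : ℂ) + Complex.I * (fderiv ℝ F z (Complex.I * u) : ℂ)) := by
  have hu0 : u ≠ 0 := norm_pos_iff.1 (by rw [hu]; exact one_pos)
  have h1 : fderiv ℝ F z u = u.re * fderiv ℝ F z 1 + u.im * fderiv ℝ F z Complex.I := by
    conv_lhs => rw [show u = u.re • (1 : ℂ) + u.im • Complex.I by
      simp [Complex.re_add_im]]
    rw [map_add, map_smul, map_smul, smul_eq_mul, smul_eq_mul]
  have h2 : fderiv ℝ F z (Complex.I * u)
      = -u.im * fderiv ℝ F z 1 + u.re * fderiv ℝ F z Complex.I := by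
    conv_lhs => rw [show Complex.I * u = (-u.im) • (1 : ℂ) + u.re • Complex.I by
      apply Complex.ext <;> simp]
    rw [map_add, map_smul, map_smul, smul_eq_mul, smul_eq_mul]
  have h3 : u⁻¹ = u.re - u.im * Complex.I := by
    rw [Complex.inv_def, Complex.normSq_eq_norm_sq, hu]
    apply Complex.ext <;> simp
  rw [h1, h2, h3, dbar]
  push_cast
  linear_combination (-1 / 2 * u.im * (fderiv ℝ F z Complex.I : ℂ)) * Complex.I_sq

/-- In polar coordinates around `ξ` the Jacobian cancels the modulus of the kernel. The radial
derivative integrates to `-F ξ` on each ray; the tangential one is an exact `θ`-derivative and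
integrates to zero on each circle. -/
theorem integral_kernel_mul_dbar (hF : ContDiff ℝ 1 F) (hc : HasCompactSupport F) (ξ : ℂ) :
    ∫ w, kernel (w - ξ) * dbar F w = -((Real.pi * F ξ : ℝ) : ℂ) := by
  obtain ⟨R, hR⟩ := hc.isCompact.isBounded.exists_norm_le
  set u : ℝ → ℂ := fun θ => (Real.cos θ : ℂ) + Real.sin θ * Complex.I with hudef
  have hun : ∀ θ, ‖u θ‖ = 1 := fun θ => by
    simp only [hudef]
    push_cast
    exact Complex.norm_cos_add_sin_mul_I θ
  have hu0 : ∀ θ, u θ ≠ 0 := fun θ => norm_pos_iff.1 (by rw [hun]; exact one_pos)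
  have huc : Continuous u := by fun_prop
  have hud : ∀ θ, HasDerivAt u (Complex.I * u θ) θ := by
    intro θ
    have h1 := (Real.hasDerivAt_cos θ).ofReal_comp
    have h2 := ((Real.hasDerivAt_sin θ).ofReal_comp).mul_const Complex.I
    convert! h1.add h2 using 1
    simp only [hudef]
    push_cast
    linear_combination (Complex.sin θ) * Complex.I_sq
  set P : ℝ × ℝ → ℝ := fun p => fderiv ℝ F (ξ + p.1 * u p.2) (u p.2) with hP
  set Q : ℝ × ℝ → ℝ := fun p => fderiv ℝ F (ξ + p.1 * u p.2) (Complex.I * u p.2) with hQ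
  set T : Set (ℝ × ℝ) := Set.Ioi 0 ×ˢ Set.Ioo (-Real.pi) Real.pi with hT
  have hTm : MeasurableSet T := measurableSet_Ioi.prod measurableSet_Ioo
  have hzero : ∀ p ∈ T \ (Set.Icc 0 (R + ‖ξ‖) ×ˢ Set.Icc (-Real.pi) Real.pi),
      fderiv ℝ F (ξ + p.1 * u p.2) = 0 := by
    rintro p ⟨⟨h1, h2⟩, h3⟩
    have h1' : 0 < p.1 := h1
    refine fderiv_eq_zero_of_lt_norm hR ?_
    have h4 : R + ‖ξ‖ < p.1 := by
      by_contra! hle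
      exact h3 ⟨⟨h1'.le, hle⟩, Set.Ioo_subset_Icc_self h2⟩
    have h5 := norm_sub_le (ξ + p.1 * u p.2) ξ
    rw [add_sub_cancel_left, norm_mul, hun, mul_one, Complex.norm_real,
      Real.norm_of_nonneg h1'.le] at h5
    linarith
  have hPi : IntegrableOn P T := by
    refine IntegrableOn.of_forall_sdiff_eq_zero
      (s := Set.Icc 0 (R + ‖ξ‖) ×ˢ Set.Icc (-Real.pi) Real.pi)
      (ContinuousOn.integrableOn_compact (isCompact_Icc.prod isCompact_Icc)
        (Continuous.continuousOn ?_)) hTm fun p hp => ?_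
    · exact continuous_fderiv_apply_comp hF (by fun_prop) (by fun_prop)
    · simp only [hP, hzero p hp]
      rfl
  have hQi : IntegrableOn Q T := by
    refine IntegrableOn.of_forall_sdiff_eq_zero
      (s := Set.Icc 0 (R + ‖ξ‖) ×ˢ Set.Icc (-Real.pi) Real.pi)
      (ContinuousOn.integrableOn_compact (isCompact_Icc.prod isCompact_Icc)
        (Continuous.continuousOn ?_)) hTm fun p hp => ?_
    · exact continuous_fderiv_apply_comp hF (by fun_prop) (by fun_prop)
    · simp only [hQ, hzero p hp]
      rfl
  have hPint : ∫ p in T, P p = -(2 * Real.pi * F ξ) := by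
    have hi := hPi
    rw [IntegrableOn, Measure.volume_eq_prod, ← Measure.prod_restrict] at hi
    rw [Measure.volume_eq_prod, ← Measure.prod_restrict, integral_prod_symm _ hi]
    have : ∀ θ, ∫ r in Set.Ioi (0 : ℝ), P (r, θ) = -F ξ := by
      intro θ
      simp only [hP]
      rw [integral_Ioi_fderiv_line hF hc _ (hu0 θ)]
      simp
    simp only [this, integral_const, MeasurableSet.univ, measureReal_restrict_apply, Set.univ_inter,
      Real.volume_real_Ioo, smul_eq_mul]
    rw [max_eq_left (by linarith [Real.pi_pos])]
    ring
  have hQint : ∫ p in T, Q p = 0 := by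
    have hi := hQi
    rw [IntegrableOn, Measure.volume_eq_prod] at hi
    rw [Measure.volume_eq_prod, setIntegral_prod _ hi]
    refine (setIntegral_congr_fun measurableSet_Ioi fun r hr => ?_).trans (integral_zero _ _)
    have hr0 : (r : ℝ) ≠ 0 := (Set.mem_Ioi.1 hr).ne'
    have hder : ∀ θ, HasDerivAt (fun θ => r⁻¹ * F (ξ + r * u θ)) (Q (r, θ)) θ := by
      intro θ
      have h1 := ((hud θ).const_mul (r : ℂ)).const_add ξ
      have h2 := ((hF.differentiable one_ne_zero _).hasFDerivAt.comp_hasDerivAt θ h1).const_mul r⁻¹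
      convert! h2 using 1
      have h4 : fderiv ℝ F (ξ + r * u θ) (r * (Complex.I * u θ)) = r * Q (r, θ) := by
        simp only [hQ]
        rw [← smul_eq_mul r, ← map_smul, Complex.real_smul]
      rw [h4, inv_mul_cancel_left₀ hr0]
    have hQc : Continuous fun θ => Q (r, θ) :=
      continuous_fderiv_apply_comp hF (by fun_prop) (by fun_prop)
    have h3 := intervalIntegral.integral_eq_sub_of_hasDerivAt (a := -Real.pi) (b := Real.pi)
      (fun θ _ => hder θ) (hQc.intervalIntegrable _ _)
    rw [intervalIntegral.integral_of_le (by linarith [Real.pi_pos]), integral_Ioc_eq_integral_Ioo]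
      at h3
    rw [h3]
    simp [hudef]
  rw [← integral_add_right_eq_self _ ξ]
  simp only [add_sub_cancel_right]
  rw [← Complex.integral_comp_polarCoord_symm, polarCoord_target, ← hT]
  have hcong : ∫ p in T, p.1 • (kernel (Complex.polarCoord.symm p)
      * dbar F (Complex.polarCoord.symm p + ξ))
      = ∫ p in T, (1 / 2 : ℂ) * ((P p : ℂ) + Complex.I * (Q p : ℂ)) := by
    refine setIntegral_congr_fun hTm fun p hp => ?_
    have hr0 : (p.1 : ℂ) ≠ 0 := by exact_mod_cast (Set.mem_Ioi.1 hp.1).ne'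
    simp only [hP, hQ]
    rw [← inv_mul_dbar (hun p.2), Complex.polarCoord_symm_apply, kernel, Complex.real_smul,
      add_comm _ ξ]
    change _ * (1 / (p.1 * u p.2) * dbar F (ξ + p.1 * u p.2)) = _
    have := hu0 p.2
    field_simp
  rw [hcong, integral_const_mul, integral_add hPi.ofReal (hQi.ofReal.const_mul _),
    integral_const_mul, integral_complex_ofReal, integral_complex_ofReal, hPint, hQint]
  push_cast
  ring

theorem integral_dbar (hF : ContDiff ℝ 1 F) (hc : HasCompactSupport F) : ∫ w, dbar F w = 0 := by
  have hi : ∀ v : ℂ, Integrable fun w => fderiv ℝ F w v := fun v =>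
    Continuous.integrable_of_hasCompactSupport
      (continuous_fderiv_apply_comp hF continuous_id continuous_const) (hc.fderiv_apply ℝ v)
  unfold dbar
  rw [integral_const_mul, integral_add (hi 1).ofReal ((hi Complex.I).ofReal.const_mul _),
    integral_const_mul, integral_complex_ofReal, integral_complex_ofReal,
    integral_fderiv_eq_zero hF hc (by simp), integral_fderiv_eq_zero hF hc (by simp)]
  simp

end CauchyPompeiu

/-! ### Nullity of the support, and the weak form of `∂T/∂z̄ = π μ`. -/

section WeakIdentity

variable {μ : Measure ℂ} {C₀ : ℝ} {F : ℂ → ℝ}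

/-- By Besicovitch differentiation `μ` has finite density at Lebesgue-almost every point, but at a
support point the lower bound forces `μ(B(z, r)) / |B(z, r)| ≥ c / (π r)`. -/
theorem volume_support_eq_zero [IsLocallyFiniteMeasure μ] {c : ℝ} (hc : 0 < c)
    (h : ∀ z ∈ μ.support, ∀ r : ℝ, 0 < r → ENNReal.ofReal (c * r) ≤ μ (Metric.ball z r)) :
    volume μ.support = 0 := by
  have h1 := Besicovitch.ae_tendsto_rnDeriv μ (volume : Measure ℂ)
  have h2 := Measure.rnDeriv_lt_top μ (volume : Measure ℂ)
  have hae : ∀ᵐ z : ℂ, z ∉ μ.support := by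
    filter_upwards [h1, h2] with z hz1 hz2 hz
    obtain ⟨M, hM, -⟩ := ENNReal.lt_iff_exists_nnreal_btwn.1 hz2
    have hsmall : ∀ᶠ r : ℝ in 𝓝[>] 0, (M * NNReal.pi : ℝ) * r < c := by
      have : ContinuousAt (fun r : ℝ => (M * NNReal.pi : ℝ) * r) 0 := by fun_prop
      exact (this.eventually_lt_const (by simpa using hc)).filter_mono nhdsWithin_le_nhds
    obtain ⟨r, ⟨hr1, hr2⟩, hr0⟩ :=
      ((hz1.eventually_lt_const hM).and hsmall |>.and self_mem_nhdsWithin).exists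
    have hr0' : (0 : ℝ) < r := hr0
    have hvol : volume (Metric.closedBall z r) = ENNReal.ofReal (r ^ 2 * NNReal.pi) := by
      rw [Complex.volume_closedBall, ENNReal.ofReal_mul (by positivity),
        ENNReal.ofReal_pow hr0'.le, ENNReal.ofReal_coe_nnreal]
    rw [hvol] at hr1
    have hpi : (0 : ℝ) < NNReal.pi := Real.pi_pos
    have hv0 : ENNReal.ofReal (r ^ 2 * NNReal.pi) ≠ 0 := by
      rw [Ne, ENNReal.ofReal_eq_zero, not_le]
      positivity
    have hlt := (ENNReal.div_lt_iff (Or.inl hv0) (Or.inl ENNReal.ofReal_ne_top)).1 hr1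
    have hle := ((h z hz r hr0').trans (measure_mono Metric.ball_subset_closedBall)).trans_lt hlt
    rw [← ENNReal.ofReal_coe_nnreal, ← ENNReal.ofReal_mul (by positivity)] at hle
    have := (ENNReal.ofReal_lt_ofReal_iff_of_nonneg (by positivity)).1 hle
    nlinarith
  simpa [ae_iff] using hae

/-- The kernel `1 / |z|` cut off to the unit disc. -/
def localKernel : ℂ → ℝ := (Metric.ball (0 : ℂ) 1).indicator fun z => ‖z‖⁻¹

theorem localKernel_nonneg (z : ℂ) : 0 ≤ localKernel z :=
  Set.indicator_nonneg (fun _ _ => by positivity) z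

theorem inv_norm_le_localKernel_add_one (z : ℂ) : ‖z‖⁻¹ ≤ localKernel z + 1 := by
  by_cases hz : z ∈ Metric.ball (0 : ℂ) 1
  · rw [localKernel, Set.indicator_of_mem hz]
    linarith
  · rw [localKernel, Set.indicator_of_notMem hz, zero_add]
    exact inv_le_one_of_one_le₀ (by simpa using hz)

theorem integrable_localKernel : Integrable localKernel := by
  refine (integrable_indicator_iff Metric.isOpen_ball.measurableSet).2 ?_
  rw [integrableOn_fun_norm_addHaar volume (f := fun y => y⁻¹)]
  refine (integrableOn_const (C := (1 : ℝ)) (by simp)).congr_fun (fun y hy => ?_) measurableSet_Ioo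
  have : y ≠ 0 := hy.1.ne'
  simp [Complex.finrank_real_complex, this]

theorem continuous_dbar (hF : ContDiff ℝ 1 F) : Continuous (dbar F) := by
  have h1 := continuous_fderiv_apply_comp hF continuous_id (continuous_const (y := (1 : ℂ)))
  have h2 := continuous_fderiv_apply_comp hF continuous_id (continuous_const (y := Complex.I))
  simp only [id] at h1 h2
  unfold dbar
  fun_prop

theorem exists_norm_dbar_le (hF : ContDiff ℝ 1 F) (hc : HasCompactSupport F) :
    ∃ M R : ℝ, 0 ≤ M ∧ 0 ≤ R ∧ ∀ w,
      ‖dbar F w‖ ≤ M * (Metric.closedBall (0 : ℂ) R).indicator 1 w := by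
  obtain ⟨R, hR⟩ := hc.isCompact.isBounded.exists_norm_le
  obtain ⟨M, hM⟩ := (isCompact_closedBall (0 : ℂ) |R|).exists_bound_of_continuousOn
    (continuous_dbar hF).continuousOn
  refine ⟨M, |R|, (norm_nonneg _).trans (hM 0 (by simp)), abs_nonneg R, fun w => ?_⟩
  by_cases hw : w ∈ Metric.closedBall (0 : ℂ) |R|
  · simpa [Set.indicator_of_mem hw] using hM w hw
  · have : dbar F w = 0 := by
      rw [dbar, fderiv_eq_zero_of_lt_norm hR]
      · simp
      · rw [mem_closedBall_zero_iff, not_le] at hw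
        exact (le_abs_self R).trans_lt hw
    simp [Set.indicator_of_notMem hw, this]

theorem integrable_kernel_mul_dbar (hF : ContDiff ℝ 1 F) (hc : HasCompactSupport F) (ξ : ℂ) :
    Integrable fun w => kernel (w - ξ) * dbar F w := by
  obtain ⟨M, R, hM, hR, h⟩ := exists_norm_dbar_le hF hc
  have hb : Integrable (fun w => M * (localKernel (w - ξ)
      + (Metric.closedBall (0 : ℂ) R).indicator 1 w)) := by
    refine ((integrable_localKernel.comp_sub_right ξ).add ?_).const_mul M
    exact (integrable_indicator_iff Metric.isClosed_closedBall.measurableSet).2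
      (integrableOn_const (C := (1 : ℝ)) (isCompact_closedBall (0 : ℂ) R).measure_lt_top.ne)
  refine hb.mono' (Measurable.aestronglyMeasurable ?_) (.of_forall fun w => ?_)
  · have := (continuous_dbar hF).measurable
    fun_prop
  · rw [norm_mul, norm_kernel]
    have h1 := inv_norm_le_localKernel_add_one (w - ξ)
    have h2 := localKernel_nonneg (w - ξ)
    have h3 := h w
    by_cases hw : w ∈ Metric.closedBall (0 : ℂ) R
    · simp only [Set.indicator_of_mem hw, Pi.one_apply, mul_one] at h3 ⊢
      calc _ ≤ (localKernel (w - ξ) + 1) * M := by gcongr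
        _ = _ := by ring
    · simp only [Set.indicator_of_notMem hw, mul_zero, add_zero] at h3 ⊢
      rw [norm_le_zero_iff.1 h3, norm_zero, mul_zero]
      positivity

theorem integrable_prod_kernel_sub_mul_dbar (hn : IsNice μ C₀) {z₀ : ℂ} (hz₀ : z₀ ∉ μ.support)
    (hF : ContDiff ℝ 1 F) (hc : HasCompactSupport F) :
    Integrable (fun p : ℂ × ℂ => (kernel (p.1 - p.2) - kernel (z₀ - p.2)) * dbar F p.1)
      (volume.prod μ) := by
  have := hn.isLocallyFiniteMeasure
  obtain ⟨A, hA0, hA⟩ := exists_one_add_norm_le μ.isClosed_support hz₀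
  obtain ⟨M, R, hM, hR, h⟩ := exists_norm_dbar_le hF hc
  have hw := hn.integrable_one_add_norm_rpow (by norm_num : (1 : ℝ) < 2)
  have hd1 := hw.convolution_integrand (ContinuousLinearMap.mul ℝ ℝ) integrable_localKernel
  have hd2 : Integrable (fun p : ℂ × ℂ =>
      (Metric.closedBall (0 : ℂ) R).indicator (1 : ℂ → ℝ) p.1 * (1 + ‖p.2‖) ^ (-2 : ℝ))
      (volume.prod μ) := by
    refine Integrable.mul_prod ?_ hw
    exact (integrable_indicator_iff Metric.isClosed_closedBall.measurableSet).2
      (integrableOn_const (C := (1 : ℝ)) (isCompact_closedBall (0 : ℂ) R).measure_lt_top.ne)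
  simp only [ContinuousLinearMap.mul_apply'] at hd1
  set C : ℝ := M * ((‖z₀‖ + R) * A) with hC
  have hC0 : 0 ≤ C := by positivity
  refine (((hd1.const_mul (1 + R)).add (hd2.const_mul (2 + R))).const_mul C).mono'
    (Measurable.aestronglyMeasurable ?_) ?_
  · have := (continuous_dbar hF).measurable
    fun_prop
  · have := hn.nullSingletonClass
    filter_upwards [ae_prod_ne volume μ,
      Measure.quasiMeasurePreserving_snd.ae (ae_mem_support μ)] with p hp hξ
    simp only [Pi.add_apply]
    have h2 := localKernel_nonneg (p.1 - p.2)
    have h3 := h p.1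
    rw [norm_mul]
    by_cases hw : p.1 ∈ Metric.closedBall (0 : ℂ) R
    · simp only [Set.indicator_of_mem hw, Pi.one_apply, mul_one, one_mul] at h3 ⊢
      have hd : 0 < ‖p.1 - p.2‖ := norm_pos_iff.2 (sub_ne_zero.2 hp)
      have hp1 : ‖p.1‖ ≤ R := by simpa using hw
      -- Here `p.1` may come close to the support, so the constant of the decay estimate is allowed
      -- to blow up like `‖p.1 - p.2‖⁻¹`, which is locally integrable in the plane.
      have h4 : 1 + ‖p.2‖ ≤ ((1 + R) * ‖p.1 - p.2‖⁻¹ + 1) * ‖p.1 - p.2‖ := by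
        have h5 : ‖p.2‖ ≤ ‖p.1‖ + ‖p.1 - p.2‖ := by simpa using norm_sub_le p.1 (p.1 - p.2)
        rw [add_mul, mul_assoc, inv_mul_cancel₀ hd.ne', mul_one, one_mul]
        linarith
      have h6 : (1 + R) * ‖p.1 - p.2‖⁻¹ + 1 ≤ (1 + R) * localKernel (p.1 - p.2) + (2 + R) := by
        have := mul_le_mul_of_nonneg_left (inv_norm_le_localKernel_add_one (p.1 - p.2))
          (show 0 ≤ 1 + R by positivity)
        linarith
      have h7 : ‖z₀ - p.1‖ ≤ ‖z₀‖ + R := (norm_sub_le _ _).trans (by gcongr)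
      calc _ ≤ (‖z₀ - p.1‖ * (((1 + R) * ‖p.1 - p.2‖⁻¹ + 1) * A) * (1 + ‖p.2‖) ^ (-2 : ℝ)) * M := by
            gcongr
            exact norm_kernel_sub_kernel_le h4 (hA _ hξ)
        _ ≤ ((‖z₀‖ + R) * (((1 + R) * localKernel (p.1 - p.2) + (2 + R)) * A)
              * (1 + ‖p.2‖) ^ (-2 : ℝ)) * M := by
            gcongr
        _ = _ := by rw [hC]; ring
    · simp only [Set.indicator_of_notMem hw, mul_zero] at h3
      rw [norm_le_zero_iff.1 h3, norm_zero, mul_zero]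
      have := Set.indicator_nonneg (s := Metric.closedBall (0 : ℂ) R) (f := (1 : ℂ → ℝ))
        (fun _ _ => zero_le_one) p.1
      positivity

/-- Fubini and Cauchy–Pompeiu; the normalization at `z₀` is constant in `w` and drops out because
`dbar F` has integral zero. -/
theorem integral_renormTransform_mul_dbar (hn : IsNice μ C₀) {z₀ : ℂ} (hz₀ : z₀ ∉ μ.support)
    (hF : ContDiff ℝ 1 F) (hc : HasCompactSupport F) :
    ∫ w, renormTransform μ z₀ w * dbar F w = -((Real.pi * ∫ ξ, F ξ ∂μ : ℝ) : ℂ) := by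
  have := hn.isLocallyFiniteMeasure
  have h1 : ∀ w, renormTransform μ z₀ w * dbar F w
      = ∫ ξ, (kernel (w - ξ) - kernel (z₀ - ξ)) * dbar F w ∂μ := fun w =>
    (integral_mul_const _ _).symm
  simp only [h1]
  rw [integral_integral_swap (integrable_prod_kernel_sub_mul_dbar hn hz₀ hF hc)]
  have hdi : Integrable (dbar F) := by
    refine (continuous_dbar hF).integrable_of_hasCompactSupport ?_
    obtain ⟨M, R, hM, hR, h⟩ := exists_norm_dbar_le hF hc
    refine HasCompactSupport.intro (isCompact_closedBall (0 : ℂ) R) fun w hw => ?_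
    have := h w
    rwa [Set.indicator_of_notMem hw, mul_zero, norm_le_zero_iff] at this
  have h2 : ∀ ξ, ∫ w, (kernel (w - ξ) - kernel (z₀ - ξ)) * dbar F w
      = ((-(Real.pi * F ξ) : ℝ) : ℂ) := by
    intro ξ
    simp only [sub_mul]
    rw [integral_sub (integrable_kernel_mul_dbar hF hc ξ) (hdi.const_mul _), integral_const_mul,
      integral_dbar hF hc, integral_kernel_mul_dbar hF hc, mul_zero, sub_zero, Complex.ofReal_neg]
  simp only [h2]
  rw [integral_complex_ofReal, integral_neg, integral_const_mul, Complex.ofReal_neg]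

end WeakIdentity

/-! ### A set whose gradient has constant direction is a half-plane. -/

section HalfPlane

variable {μ : Measure ℂ} {C₀ : ℝ}

theorem two_mul_integral_dbar {F : ℂ → ℝ} (hF : ContDiff ℝ 1 F) (hc : HasCompactSupport F)
    (Ω : Set ℂ) : 2 * ∫ w in Ω, dbar F w
      = ((∫ w in Ω, fderiv ℝ F w 1 : ℝ) : ℂ)
        + Complex.I * ((∫ w in Ω, fderiv ℝ F w Complex.I : ℝ) : ℂ) := by
  have hi : ∀ v : ℂ, Integrable (fun w => fderiv ℝ F w v) (volume.restrict Ω) := fun v =>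
    (Continuous.integrable_of_hasCompactSupport
      (continuous_fderiv_apply_comp hF continuous_id continuous_const)
      (hc.fderiv_apply ℝ v)).restrict
  unfold dbar
  rw [integral_const_mul, integral_add (hi 1).ofReal ((hi Complex.I).ofReal.const_mul _),
    integral_const_mul, integral_complex_ofReal, integral_complex_ofReal]
  ring

/-- For real `F` the single complex number `∫ dbar F` encodes both partial derivatives, hence every
directional one. -/
theorem integral_fderiv_apply {F : ℂ → ℝ} (hF : ContDiff ℝ 1 F) (hc : HasCompactSupport F)
    (Ω : Set ℂ) (e : ℂ) : ∫ w in Ω, fderiv ℝ F w e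
      = (starRingEnd ℂ e * (2 * ∫ w in Ω, dbar F w)).re := by
  have hi : ∀ v : ℂ, Integrable (fun w => fderiv ℝ F w v) (volume.restrict Ω) := fun v =>
    (Continuous.integrable_of_hasCompactSupport
      (continuous_fderiv_apply_comp hF continuous_id continuous_const)
      (hc.fderiv_apply ℝ v)).restrict
  have h1 : ∀ w, fderiv ℝ F w e = e.re * fderiv ℝ F w 1 + e.im * fderiv ℝ F w Complex.I := by
    intro w
    conv_lhs => rw [show e = e.re • (1 : ℂ) + e.im • Complex.I by simp [Complex.re_add_im]]
    rw [map_add, map_smul, map_smul, smul_eq_mul, smul_eq_mul]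
  simp only [h1]
  rw [two_mul_integral_dbar hF hc,
    integral_add ((hi 1).const_mul _) ((hi Complex.I).const_mul _), integral_const_mul,
    integral_const_mul]
  simp

/-- If the directional derivatives of `1_Ω` are the multiples `Re(λ e) μ` of a measure, then
integrals over `Ω` of non-negative functions increase along directions with `Re(λ e) ≥ 0`. -/
theorem integral_le_integral_translate {Ω : Set ℂ} {lam : ℂ} (hlam : lam ≠ 0)
    (h : ∀ F : ℂ → ℝ, ContDiff ℝ 1 F → HasCompactSupport F → ∀ e : ℂ,
      ‖lam‖ ^ 2 * ∫ w in Ω, fderiv ℝ F w e = -(Real.pi * (lam * e).re * ∫ ξ, F ξ ∂μ))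
    {F : ℂ → ℝ} (hF : ContDiff ℝ 1 F) (hc : HasCompactSupport F) (hF0 : ∀ z, 0 ≤ F z) {e : ℂ}
    (he : 0 ≤ (lam * e).re) : ∫ w in Ω, F w ≤ ∫ w in Ω, F (w - e) := by
  have htr : ∀ t : ℝ, ContDiff ℝ 1 (fun w => F (w - t * e)) := fun t =>
    hF.comp (contDiff_id.sub contDiff_const)
  have htc : ∀ t : ℝ, HasCompactSupport (fun w => F (w - t * e)) := fun t => by
    have := hc.comp_homeomorph (Homeomorph.subRight (t * e))
    exact this
  have hderiv : ∀ t : ℝ, HasDerivAt (fun t : ℝ => ∫ w in Ω, F (w - t * e))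
      (∫ w in Ω, -(fderiv ℝ F (w - t * e) e)) t := by
    intro t
    obtain ⟨R, hR⟩ := hc.isCompact.isBounded.exists_norm_le
    have hDc : Continuous fun w => fderiv ℝ F w e :=
      continuous_fderiv_apply_comp hF continuous_id continuous_const
    obtain ⟨M, hM⟩ := (hc.fderiv_apply ℝ e).exists_bound_of_continuous hDc
    have hM0 : 0 ≤ M := (norm_nonneg _).trans (hM 0)
    set R' : ℝ := R + (|t| + 1) * ‖e‖ with hR'
    refine (hasDerivAt_integral_of_dominated_loc_of_deriv_le (μ := volume.restrict Ω)
      (F := fun (t : ℝ) w => F (w - t * e)) (F' := fun (t : ℝ) w => -(fderiv ℝ F (w - t * e) e))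
      (bound := (Metric.closedBall (0 : ℂ) R').indicator fun _ => M)
      (Metric.ball_mem_nhds t one_pos) (.of_forall fun s => ?_) ?_ ?_
      (.of_forall fun w s hs => ?_) ?_ (.of_forall fun w s _ => ?_)).2
    · exact (htr s).continuous.aestronglyMeasurable
    · exact ((htr t).continuous.integrable_of_hasCompactSupport (htc t)).restrict
    · have hcont : Continuous fun w => fderiv ℝ F (w - t * e) e :=
        continuous_fderiv_apply_comp hF (by fun_prop) continuous_const
      exact hcont.neg.aestronglyMeasurable
    · by_cases hw : w ∈ Metric.closedBall (0 : ℂ) R'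
      · rw [Set.indicator_of_mem hw, norm_neg]
        exact hM _
      · rw [Set.indicator_of_notMem hw, fderiv_eq_zero_of_lt_norm hR]
        · simp
        · rw [mem_closedBall_zero_iff, not_le, hR'] at hw
          have h1 : |s| ≤ |t| + 1 := by
            have h2 : |s - t| < 1 := by simpa [Real.dist_eq] using hs
            have := abs_sub_abs_le_abs_sub s t
            linarith
          have h3 := norm_sub_norm_le w (s * e)
          rw [norm_mul, Complex.norm_real, Real.norm_eq_abs] at h3
          have := mul_le_mul_of_nonneg_right h1 (norm_nonneg e)
          linarith
    · exact ((integrable_indicator_iff Metric.isClosed_closedBall.measurableSet).2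
        (integrableOn_const (C := M) (isCompact_closedBall (0 : ℂ) R').measure_lt_top.ne)).restrict
    · have := hasDerivAt_comp_line hF w (-e) s
      simpa [← sub_eq_add_neg] using this
  -- The `t`-derivative is `-∫_Ω ∂_e F(· - te)`, which by `h` is a non-negative multiple of the
  -- `μ`-integral of the translate of `F`.
  have hmono : Monotone fun t : ℝ => ∫ w in Ω, F (w - t * e) := by
    refine monotone_of_hasDerivAt_nonneg hderiv fun t => ?_
    have h1 := h _ (htr t) (htc t) e
    simp only [fderiv_comp_sub] at h1
    rw [integral_neg]
    have h2 : 0 ≤ ∫ ξ, F (ξ - t * e) ∂μ := integral_nonneg fun _ => hF0 _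
    have h3 : 0 < ‖lam‖ ^ 2 := by positivity
    have h4 : 0 ≤ Real.pi * (lam * e).re * ∫ ξ, F (ξ - t * e) ∂μ := by positivity
    change 0 ≤ -∫ w in Ω, fderiv ℝ F (w - t * e) e
    by_contra hneg
    have h5 : 0 < ∫ w in Ω, fderiv ℝ F (w - t * e) e := by linarith
    have h6 := mul_pos h3 h5
    linarith
  simpa using hmono (zero_le_one (α := ℝ))

/-- Otherwise a bump inside `Ω` around `x` could be translated by `x' - x`, a direction in which its
integral over `Ω` cannot decrease, yet it would land in `Ω'` and lose all its mass in `Ω`. -/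
theorem re_mul_lt_re_mul {Ω Ω' : Set ℂ} (hΩ : IsOpen Ω) (hΩ' : IsOpen Ω') (hdisj : Disjoint Ω Ω')
    {lam : ℂ} (hlam : lam ≠ 0)
    (h : ∀ F : ℂ → ℝ, ContDiff ℝ 1 F → HasCompactSupport F → ∀ e : ℂ,
      ‖lam‖ ^ 2 * ∫ w in Ω, fderiv ℝ F w e = -(Real.pi * (lam * e).re * ∫ ξ, F ξ ∂μ))
    {x x' : ℂ} (hx : x ∈ Ω) (hx' : x' ∈ Ω') : (lam * x').re < (lam * x).re := by
  by_contra! hle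
  obtain ⟨ε, hε, hball⟩ := Metric.isOpen_iff.1 hΩ x hx
  obtain ⟨ε', hε', hball'⟩ := Metric.isOpen_iff.1 hΩ' x' hx'
  set r := min ε ε' with hr
  have hr0 : 0 < r := lt_min hε hε'
  let f : ContDiffBump x := ⟨r / 2, r, by positivity, by linarith⟩
  have hsupp : ∀ z, f z ≠ 0 → z ∈ Metric.ball x r := fun z hz => by
    have h1 : Function.support f = Metric.ball x r := f.support_eq
    rw [← h1]
    exact hz
  have hle' := integral_le_integral_translate hlam h (F := f) f.contDiff f.hasCompactSupport
    (fun z => f.nonneg) (e := x' - x) (by rw [mul_sub, Complex.sub_re]; linarith)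
  have h1 : ∫ w in Ω, f w = ∫ w, f w := by
    refine setIntegral_eq_integral_of_forall_compl_eq_zero fun w hw => ?_
    by_contra hne
    exact hw (hball (Metric.ball_subset_ball (min_le_left _ _) (hsupp w hne)))
  have h2 : ∫ w in Ω, f (w - (x' - x)) = 0 := by
    refine setIntegral_eq_zero_of_forall_eq_zero fun w hw => ?_
    by_contra hne
    have h3 := hsupp _ hne
    have h4 : w ∈ Metric.ball x' ε' := by
      rw [mem_ball_iff_norm] at h3 ⊢
      rw [show w - x' = w - (x' - x) - x by ring]
      exact h3.trans_le (min_le_right _ _)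
    exact Set.disjoint_left.1 hdisj hw (hball' h4)
  rw [h1, h2] at hle'
  exact absurd (f.integral_pos (μ := volume)) (not_lt.2 hle')

/-- The threshold is the infimum of `Re(lam w)` over `Ω`. It is not attained as `Ω` is open, and all
of `Ω'` lies at or below it. -/
theorem exists_ae_eq_halfPlane {Ω Ω' : Set ℂ} (hΩ : IsOpen Ω) (hΩ' : IsOpen Ω')
    (hdisj : Disjoint Ω Ω') (hne : Ω.Nonempty) (hne' : Ω'.Nonempty)
    (hnull : volume (Ω ∪ Ω')ᶜ = 0) {lam : ℂ} (hlam : lam ≠ 0)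
    (h : ∀ F : ℂ → ℝ, ContDiff ℝ 1 F → HasCompactSupport F → ∀ e : ℂ,
      ‖lam‖ ^ 2 * ∫ w in Ω, fderiv ℝ F w e = -(Real.pi * (lam * e).re * ∫ ξ, F ξ ∂μ)) :
    ∃ a : ℝ, Ω =ᵐ[volume] {w : ℂ | a < (lam * w).re} := by
  set S : Set ℝ := (fun w : ℂ => (lam * w).re) '' Ω with hS
  have hlb : ∀ x' ∈ Ω', (lam * x').re ∈ lowerBounds S := by
    rintro x' hx' _ ⟨x, hx, rfl⟩
    exact (re_mul_lt_re_mul hΩ hΩ' hdisj hlam h hx hx').le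
  have hbdd : BddBelow S := hne'.elim fun x' hx' => ⟨_, hlb x' hx'⟩
  have hSne : S.Nonempty := hne.image _
  have hΩsub : ∀ w ∈ Ω, sInf S < (lam * w).re := by
    intro w hw
    obtain ⟨ε, hε, hball⟩ := Metric.isOpen_iff.1 hΩ w hw
    -- A move by `ε / 2` along `-conj lam`, the direction in which `Re(lam w)` decreases fastest.
    set s : ℝ := ε / (2 * ‖lam‖) with hs
    have hl : 0 < ‖lam‖ := norm_pos_iff.2 hlam
    have hs0 : 0 < s := by positivity
    have hmem : w - s * starRingEnd ℂ lam ∈ Ω := by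
      refine hball ?_
      rw [mem_ball_iff_norm, sub_sub_cancel_left, norm_neg, norm_mul, RCLike.norm_conj,
        Complex.norm_real, Real.norm_of_nonneg hs0.le, hs]
      have : ε / (2 * ‖lam‖) * ‖lam‖ = ε / 2 := by field_simp
      linarith
    have h1 : sInf S ≤ _ := csInf_le hbdd ⟨_, hmem, rfl⟩
    have h2 : lam * (w - s * starRingEnd ℂ lam) = lam * w - ((s * ‖lam‖ ^ 2 : ℝ) : ℂ) := by
      have := Complex.mul_conj' lam
      push_cast
      linear_combination (-(s : ℂ)) * this
    simp only [h2, Complex.sub_re, Complex.ofReal_re] at h1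
    have : 0 < s * ‖lam‖ ^ 2 := by positivity
    linarith
  refine ⟨sInf S, ?_⟩
  have hae : ∀ᵐ w : ℂ, w ∈ Ω ∪ Ω' := by
    rw [ae_iff]
    exact hnull
  filter_upwards [hae] with w hw
  refine propext ⟨fun hwΩ => hΩsub w hwΩ, fun hlt => ?_⟩
  rcases hw with hw | hw
  · exact hw
  · exact absurd (le_csInf hSne (hlb w hw)) (not_le.2 hlt)

end HalfPlane

/-! ### Identification of the measure on the boundary line. -/

section Conclusion

/-- A bounded open set is the support of a non-negative `C¹` function `f`, and `smoothTransition (n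
f)` converges to its indicator. Exhaustion by discs and outer regularity do the rest. -/
theorem measure_ext_of_integral_contDiff {μ ν : Measure ℂ} [IsLocallyFiniteMeasure μ]
    [IsLocallyFiniteMeasure ν]
    (h : ∀ F : ℂ → ℝ, ContDiff ℝ 1 F → HasCompactSupport F → ∫ z, F z ∂μ = ∫ z, F z ∂ν) :
    μ = ν := by
  have key : ∀ (μ : Measure ℂ) [IsLocallyFiniteMeasure μ] (U : Set ℂ), IsOpen U →
      Bornology.IsBounded U → ∀ f : ℂ → ℝ, Function.support f = U → ContDiff ℝ 1 f →
      (∀ z, 0 ≤ f z) → Filter.Tendsto (fun n : ℕ => ∫ z, Real.smoothTransition (n * f z) ∂μ)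
        Filter.atTop (𝓝 (μ.real U)) := by
    intro μ _ U hU hb f hf hfc hf0
    rw [← integral_indicator_one hU.measurableSet]
    have hUfin : μ U ≠ ⊤ := hb.measure_lt_top.ne
    refine tendsto_integral_of_dominated_convergence (U.indicator 1) (fun n => ?_)
      ((integrable_indicator_iff hU.measurableSet).2 (integrableOn_const (C := (1 : ℝ)) hUfin))
      (fun n => .of_forall fun z => ?_) (.of_forall fun z => ?_)
    · exact (Real.smoothTransition.continuous.comp
        (continuous_const.mul hfc.continuous)).aestronglyMeasurable
    · rw [Real.norm_of_nonneg (Real.smoothTransition.nonneg _)]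
      by_cases hz : z ∈ U
      · rw [Set.indicator_of_mem hz]
        exact Real.smoothTransition.le_one _
      · have : f z = 0 := by
          rw [← hf] at hz
          simpa using hz
        rw [Set.indicator_of_notMem hz, this, mul_zero, Real.smoothTransition.zero]
    · by_cases hz : z ∈ U
      · have hpos : 0 < f z := by
          rw [← hf] at hz
          exact lt_of_le_of_ne (hf0 z) (Ne.symm hz)
        rw [Set.indicator_of_mem hz]
        refine tendsto_const_nhds.congr' ?_
        filter_upwards [Filter.eventually_ge_atTop ⌈1 / f z⌉₊] with n hn
        refine (Real.smoothTransition.one_of_one_le ?_).symm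
        have := (Nat.le_ceil _).trans (Nat.cast_le.2 hn)
        rwa [div_le_iff₀ hpos] at this
      · have : f z = 0 := by
          rw [← hf] at hz
          simpa using hz
        simp [Set.indicator_of_notMem hz, this, Real.smoothTransition.zero]
  have hbdd : ∀ U : Set ℂ, IsOpen U → Bornology.IsBounded U → μ U = ν U := by
    intro U hU hb
    obtain ⟨f, hf, hfc, hfr⟩ := hU.exists_contDiff_support_eq (n := 1)
    have hfc' : ContDiff ℝ 1 f := by exact_mod_cast hfc
    have hf0 : ∀ z, 0 ≤ f z := fun z => (hfr ⟨z, rfl⟩).1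
    have h1 := key μ U hU hb f hf hfc' hf0
    have h2 := key ν U hU hb f hf hfc' hf0
    have h3 : ∀ n : ℕ, ∫ z, Real.smoothTransition (n * f z) ∂μ
        = ∫ z, Real.smoothTransition (n * f z) ∂ν := by
      intro n
      refine h _ ?_ ?_
      · exact (Real.smoothTransition.contDiff (n := 1)).comp (contDiff_const.mul hfc')
      · have hfs : HasCompactSupport f := by
          rw [HasCompactSupport, tsupport, hf]
          exact Metric.isCompact_of_isClosed_isBounded isClosed_closure hb.closure
        exact hfs.comp_left (g := fun x => Real.smoothTransition (n * x)) (by simp)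
    simp only [h3] at h1
    have h4 := tendsto_nhds_unique h1 h2
    exact (measureReal_eq_measureReal_iff hb.measure_lt_top.ne hb.measure_lt_top.ne).1 h4
  refine Measure.OuterRegular.ext_isOpen fun U hU => ?_
  have hmono : Monotone fun n : ℕ => U ∩ Metric.ball 0 n := fun m n hmn =>
    Set.inter_subset_inter_right _ (Metric.ball_subset_ball (Nat.cast_le.2 hmn))
  have hUn : ⋃ n : ℕ, U ∩ Metric.ball 0 n = U := by
    rw [← Set.inter_iUnion, Metric.iUnion_ball_nat, Set.inter_univ]
  have h1 := tendsto_measure_iUnion_atTop (μ := μ) hmono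
  have h2 := tendsto_measure_iUnion_atTop (μ := ν) hmono
  rw [hUn] at h1 h2
  have h3 : ⇑μ ∘ (fun n : ℕ => U ∩ Metric.ball 0 n) = ⇑ν ∘ fun n : ℕ => U ∩ Metric.ball 0 n :=
    funext fun n => hbdd _ (hU.inter Metric.isOpen_ball)
      (Metric.isBounded_ball.subset Set.inter_subset_right)
  rw [h3] at h1
  exact tendsto_nhds_unique h1 h2

theorem exists_line_eq_smul_hausdorffMeasure {μ : Measure ℂ} [IsLocallyFiniteMeasure μ] {Ω : Set ℂ}
    {lam : ℂ} (hlam : lam ≠ 0)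
    (h : ∀ F : ℂ → ℝ, ContDiff ℝ 1 F → HasCompactSupport F → ∀ e : ℂ,
      ‖lam‖ ^ 2 * ∫ w in Ω, fderiv ℝ F w e = -(Real.pi * (lam * e).re * ∫ ξ, F ξ ∂μ))
    {a : ℝ} (ha : Ω =ᵐ[volume] {w : ℂ | a < (lam * w).re}) :
    ∃ (L : AffineSubspace ℝ ℂ) (c : ℝ≥0), Module.finrank ℝ L.direction = 1 ∧ 0 < c ∧
      μ = c • (Measure.hausdorffMeasure 1 : Measure ℂ).restrict (L : Set ℂ) := by
  have hl : 0 < ‖lam‖ := norm_pos_iff.2 hlam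
  set ρ : ℂ := lam / (‖lam‖ : ℂ) with hρdef
  have hlC : (‖lam‖ : ℂ) ≠ 0 := by exact_mod_cast hl.ne'
  have hρlam : lam = ‖lam‖ * ρ := by
    rw [hρdef]
    field_simp
  have hρ : ‖ρ‖ = 1 := by
    rw [hρdef, norm_div, Complex.norm_real, norm_norm, div_self hl.ne']
  set u : ℂ := starRingEnd ℂ ρ with hu
  have hun : ‖u‖ = 1 := by rw [hu, RCLike.norm_conj, hρ]
  have hu0 : u ≠ 0 := norm_pos_iff.1 (by rw [hun]; exact one_pos)
  set b : ℝ := a / ‖lam‖ with hb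
  have hset : {w : ℂ | a < (lam * w).re} = {w : ℂ | b < (ρ * w).re} := by
    ext w
    change a < (lam * w).re ↔ b < (ρ * w).re
    rw [hb, div_lt_iff₀ hl]
    nth_rewrite 1 [hρlam]
    rw [mul_assoc, Complex.re_ofReal_mul, mul_comm]
  set γ : ℝ → ℂ := fun t => u * (b + t * Complex.I) with hγ
  have hiso : Isometry γ := by
    refine Isometry.of_dist_eq fun s t => ?_
    rw [dist_eq_norm, hγ]
    simp only
    rw [← mul_sub, norm_mul, hun, one_mul, add_sub_add_left_eq_sub, ← sub_mul, norm_mul,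
      Complex.norm_I, mul_one, ← Complex.ofReal_sub, Complex.norm_real, dist_eq_norm]
  set L : AffineSubspace ℝ ℂ := AffineSubspace.mk' (u * b) (Submodule.span ℝ {u * Complex.I}) with hL
  have hrange : (L : Set ℂ) = Set.range γ := by
    ext z
    rw [SetLike.mem_coe, hL, AffineSubspace.mem_mk', Submodule.mem_span_singleton, Set.mem_range]
    refine exists_congr fun t => ?_
    rw [hγ, vsub_eq_sub, eq_sub_iff_add_eq, Complex.real_smul]
    simp only
    rw [show u * (b + t * Complex.I) = t * (u * Complex.I) + u * b by ring]
  -- Testing `h` along the unit normal `u`, where `lam * u = ‖lam‖`, gives `‖lam‖² ∫_L F = π ‖lam‖ ∫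
  -- F dμ`.
  set c : ℝ≥0 := ⟨‖lam‖ / Real.pi, by positivity⟩ with hc
  have hc0 : 0 < c := by
    rw [← NNReal.coe_pos]
    change 0 < ‖lam‖ / Real.pi
    positivity
  refine ⟨L, c, ?_, hc0, ?_⟩
  · rw [hL, AffineSubspace.direction_mk']
    exact finrank_span_singleton (mul_ne_zero hu0 Complex.I_ne_zero)
  · rw [hrange, ← hiso.map_hausdorffMeasure (Or.inl zero_le_one), hausdorffMeasure_real]
    have hemb := hiso.isClosedEmbedding.measurableEmbedding
    have hlf : IsLocallyFiniteMeasure (Measure.map γ volume) := by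
      refine ⟨fun z => ⟨Metric.ball z 1, Metric.ball_mem_nhds z one_pos, ?_⟩⟩
      rw [hemb.map_apply]
      exact (hiso.antilipschitz.isBounded_preimage Metric.isBounded_ball).measure_lt_top
    refine measure_ext_of_integral_contDiff fun F hF hFc => ?_
    have h1 := h F hF hFc u
    have h2 : (lam * u).re = ‖lam‖ := by
      rw [hρlam, mul_assoc, hu, Complex.mul_conj, Complex.normSq_eq_norm_sq, hρ]
      simp [hρ]
    rw [setIntegral_congr_set ha, hset, hu, integral_halfPlane_fderiv hF hFc hρ b, ← hu, h2] at h1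
    rw [integral_smul_nnreal_measure, hemb.integral_map]
    change _ = (‖lam‖ / Real.pi) * ∫ t : ℝ, F (u * (b + t * Complex.I))
    have hpi := Real.pi_pos
    rw [div_mul_eq_mul_div, eq_div_iff hpi.ne']
    refine mul_left_cancel₀ hl.ne' ?_
    linarith

end Conclusion

end CauchyTransform

end

/-! ### Assembly of the proof. -/

open CauchyTransform in
theorem mainTheorem2 (μ : MeasureTheory.Measure ℂ) (hμ : μ ≠ 0)
    (hgood : CauchyTransform.IsGood μ) (hAD : CauchyTransform.IsADRegular μ)
    (hrefl : CauchyTransform.IsReflectionless μ) :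
    ∃ (L : AffineSubspace ℝ ℂ) (c : NNReal),
      Module.finrank ℝ L.direction = 1 ∧ 0 < c ∧
        μ = c • (MeasureTheory.Measure.hausdorffMeasure 1 : MeasureTheory.Measure ℂ).restrict
          (L : Set ℂ) := by
  obtain ⟨C₀, -, hn, -⟩ := hgood
  obtain ⟨-, c₀, hc₀, hlower⟩ := hAD
  obtain ⟨z₀, hz₀, hpair⟩ := hrefl
  have := hn.isLocallyFiniteMeasure
  have hE := volume_support_eq_zero hc₀ hlower
  obtain ⟨lam, hlam⟩ := exists_integral_symIntegrand_eq hn hz₀ hpair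
  set T : ℂ → ℂ := renormTransform μ z₀ with hT
  have hcont : ContinuousOn T μ.supportᶜ := fun w hw =>
    (continuousAt_renormTransform hn hz₀ hw).continuousWithinAt
  set Ω : Set ℂ := {w | w ∉ μ.support ∧ T w ≠ 0} with hΩdef
  have hTΩ : ∀ w ∈ Ω, T w = 2 * lam := by
    rintro w ⟨hw, hne⟩
    have := renormTransform_sq hn hz₀ hw hlam
    refine mul_right_cancel₀ hne ?_
    linear_combination 2 * this
  -- Since `T` is `0` or `2 lam`, for `lam ≠ 0` this is the zero set of `T` off the support, in a
  -- form that is open by continuity alone.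
  set Ω' : Set ℂ := {w | w ∉ μ.support ∧ ‖T w‖ < ‖lam‖} with hΩ'def
  have hΩ : IsOpen Ω := hcont.isOpen_inter_preimage μ.isOpen_compl_support isOpen_compl_singleton
  have hΩ' : IsOpen Ω' :=
    hcont.norm.isOpen_inter_preimage μ.isOpen_compl_support (isOpen_Iio (a := ‖lam‖))
  have hraw : ∀ F : ℂ → ℝ, ContDiff ℝ 1 F → HasCompactSupport F →
      lam * (2 * ∫ w in Ω, dbar F w) = -((Real.pi * ∫ ξ, F ξ ∂μ : ℝ) : ℂ) := by
    intro F hF hc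
    rw [← integral_renormTransform_mul_dbar hn hz₀ hF hc, ← mul_assoc, ← integral_const_mul,
      ← integral_indicator hΩ.measurableSet]
    refine integral_congr_ae ?_
    have hae : ∀ᵐ w : ℂ, w ∉ μ.support := measure_eq_zero_iff_ae_notMem.1 hE
    filter_upwards [hae] with w hw
    by_cases hwΩ : w ∈ Ω
    · rw [Set.indicator_of_mem hwΩ, ← hT, hTΩ w hwΩ]
      ring
    · have h0 : T w = 0 := by
        by_contra hne
        exact hwΩ ⟨hw, hne⟩
      rw [Set.indicator_of_notMem hwΩ, ← hT, h0, zero_mul]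
  -- If `T` vanished off the null support, its weak derivative `π μ` would vanish too.
  have hne : Ω.Nonempty := by
    by_contra hemp
    rw [Set.not_nonempty_iff_eq_empty] at hemp
    refine hμ (measure_ext_of_integral_contDiff fun F hF hc => ?_)
    have h1 := hraw F hF hc
    rw [hemp, setIntegral_empty, mul_zero, mul_zero, eq_comm, neg_eq_zero, Complex.ofReal_eq_zero]
      at h1
    rw [integral_zero_measure]
    exact (mul_eq_zero.1 h1).resolve_left Real.pi_ne_zero
  have hlam0 : lam ≠ 0 := by
    obtain ⟨w, hw⟩ := hne
    rintro rfl
    exact hw.2 (by rw [hTΩ w hw, mul_zero])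
  have hl : 0 < ‖lam‖ := norm_pos_iff.2 hlam0
  have hdisj : Disjoint Ω Ω' := by
    refine Set.disjoint_left.2 fun w hw hw' => ?_
    have h1 := hw'.2
    rw [hTΩ w hw, norm_mul, Complex.norm_two] at h1
    linarith
  have hne' : Ω'.Nonempty := by
    refine ⟨z₀, hz₀, ?_⟩
    have : T z₀ = 0 := by simp [hT, renormTransform]
    rwa [this, norm_zero]
  have hnull : volume (Ω ∪ Ω')ᶜ = 0 := by
    refine measure_mono_null (fun w hw => ?_) hE
    by_contra hwE
    refine hw ?_
    by_cases h0 : T w = 0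
    · exact Or.inr ⟨hwE, by rwa [h0, norm_zero]⟩
    · exact Or.inl ⟨hwE, h0⟩
  have hweak : ∀ F : ℂ → ℝ, ContDiff ℝ 1 F → HasCompactSupport F → ∀ e : ℂ,
      ‖lam‖ ^ 2 * ∫ w in Ω, fderiv ℝ F w e = -(Real.pi * (lam * e).re * ∫ ξ, F ξ ∂μ) := by
    intro F hF hc e
    have h1 := hraw F hF hc
    rw [integral_fderiv_apply hF hc, ← Complex.re_ofReal_mul, Complex.ofReal_pow,
      ← Complex.conj_mul' lam]
    -- Multiplying `hraw` by `conj (lam * e)` and taking real parts turns the complex identity into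
    -- one for the derivative along `e`.
    rw [show starRingEnd ℂ lam * lam * (starRingEnd ℂ e * (2 * ∫ w in Ω, dbar F w))
      = starRingEnd ℂ (lam * e) * (lam * (2 * ∫ w in Ω, dbar F w)) by rw [map_mul]; ring, h1,
      mul_neg, Complex.neg_re, mul_comm, Complex.re_ofReal_mul, Complex.conj_re]
    ring
  obtain ⟨a, ha⟩ := exists_ae_eq_halfPlane hΩ hΩ' hdisj hne hne' hnull hlam0 hweak
  exact exists_line_eq_smul_hausdorffMeasure hlam0 hweak ha
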